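/- Theorem. Let $p$ be a prime and let $x_1,\dots,x_m\in\mathbb{Z}_p$ have pairwise distinct reductions modulo $p$. Let $\mathcal{C}_{X_m}$ be the set of $m$-tuples $(H_1,\dots,H_m)$ of finitely generated $\mathbb{Z}_p$-modules for which there exist an integer $n\ge 0$ and a single matrix $A\in \mathrm{M}_n(\mathbb{Z}_p)$ such that $\mathrm{cok}(A+px_iI_n)\cong H_i$ as $\mathbb{Z}_p$-modules for every $1\le i\le m$; here $\mathrm{cok}(B)=\mathbb{Z}_p^n/B\mathbb{Z}_p^n$. For finitely generated $\mathbb{Z}_p$-modules $H_1,\dots,H_m$ write $H_i\cong\mathbb{Z}_p^{d_{\infty,i}}\times\prod_{r\ge 1}(\mathbb{Z}/p^r\mathbb{Z})^{d_{r,i}}$ with $d_{\infty,i},d_{r,i}\ge 0$ and only finitely many $d_{r,i}$ nonzero, and put $D_r:=\sum_{i=1}^m d_{r,i}$ and $s_i:=\dim_{\mathbb{F}_p}(H_i/pH_i)$. Then: 1. for $m=1$, every finitely generated $\mathbb{Z}_p$-module $H_1$ lies in $\mathcal{C}_{X_1}$; 2. for $m=2$, $(H_1,H_2)\in\mathcal{C}_{X_2}$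 if and only if $s_1=s_2$; 3. for $m=3$, $(H_1,H_2,H_3)\in\mathcal{C}_{X_3}$ if and only if $s_1=s_2=s_3$ and $2d_{1,i}\le D_1$ for $1\le i\le 3$; 4. for $m=4$, $(H_1,H_2,H_3,H_4)\in\mathcal{C}_{X_4}$ if and only if $s_1=s_2=s_3=s_4$, $3d_{1,i}\le D_1$ for $1\le i\le 4$, and $d_{1,i}+2(d_{1,j}+d_{2,j})\le D_1+D_2$ for all $1\le i,j\le 4$ (including $i=j$). In particular, for $1\le m\le 4$ the set $\mathcal{C}_{X_m}$ does not depend on the choice of $x_1,\dots,x_m$ with pairwise distinct reductions modulo $p$. -/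

import Mathlib

universe u

/-- The cokernel `ℤ_p^n / A ℤ_p^n` of a square matrix `A` over `ℤ_p`. -/
abbrev cok {p : ℕ} [Fact p.Prime] {n : ℕ} (A : Matrix (Fin n) (Fin n) ℤ_[p]) : Type :=
  (Fin n → ℤ_[p]) ⧸ LinearMap.range A.mulVecLin

/-- The reductions modulo `p` of `x_1, …, x_m` are pairwise distinct. -/
def DistinctModP {p : ℕ} [Fact p.Prime] {m : ℕ} (x : Fin m → ℤ_[p]) : Prop :=
  Function.Injective fun i => PadicInt.toZMod (x i)

/-- `(H_1, …, H_m)` belongs to `𝒞_{X_m}`, where `X_m = (x_1, …, x_m)`: for some `n` there is a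
single `n × n` matrix `A` over `ℤ_p` such that `cok (A + p x_i I) ≅ H_i` for every `i`. -/
def MemC {p : ℕ} [Fact p.Prime] {m : ℕ} (x : Fin m → ℤ_[p])
    (H : Fin m → Type*) [∀ i, AddCommGroup (H i)] [∀ i, Module ℤ_[p] (H i)] : Prop :=
  ∃ (n : ℕ) (A : Matrix (Fin n) (Fin n) ℤ_[p]),
    ∀ i, Nonempty
      (cok (A + ((p : ℤ_[p]) * x i) • (1 : Matrix (Fin n) (Fin n) ℤ_[p])) ≃ₗ[ℤ_[p]] H i)

/-- The cyclic module `ℤ_p / p^r ℤ_p` (which is `ℤ / p^r ℤ`). -/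
abbrev CyclicMod (p : ℕ) [Fact p.Prime] (r : ℕ) : Type :=
  ℤ_[p] ⧸ Ideal.span {(p : ℤ_[p]) ^ r}

/-- `H ≅ ℤ_p^{dInf} × ∏_{r ≥ 1} (ℤ / p^r ℤ)^{d r}`. -/
def HasType (p : ℕ) [Fact p.Prime] (H : Type*) [AddCommGroup H] [Module ℤ_[p] H]
    (dInf : ℕ) (d : ℕ+ →₀ ℕ) : Prop :=
  Nonempty (H ≃ₗ[ℤ_[p]] (Fin dInf → ℤ_[p]) × ((r : ℕ+) → Fin (d r) → CyclicMod p r))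

/-- The `p`-rank `s(H) = rank_{𝔽_p} (H / pH)`, where `𝔽_p = ℤ_p / p ℤ_p`. -/
noncomputable def pRank (p : ℕ) [Fact p.Prime] (H : Type*) [AddCommGroup H]
    [Module ℤ_[p] H] : ℕ :=
  Module.finrank (ℤ_[p] ⧸ Ideal.span {(p : ℤ_[p])})
    (H ⧸ (Ideal.span {(p : ℤ_[p])} • (⊤ : Submodule ℤ_[p] H)))

/-- Every finitely generated `ℤ_p`-module has a decomposition as in `HasType`. -/
theorem exists_hasType (p : ℕ) [Fact p.Prime] (H : Type*) [AddCommGroup H] [Module ℤ_[p] H]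
    [Module.Finite ℤ_[p] H] : ∃ (dInf : ℕ) (d : ℕ+ →₀ ℕ), HasType p H dInf d := by
  classical
  obtain ⟨n, ι, _, q, hq, e, ⟨f⟩⟩ := Module.equiv_free_prod_directSum (R := ℤ_[p]) (M := H)
  have hspan : ∀ i, Ideal.span {q i ^ e i} = Ideal.span {(p : ℤ_[p]) ^ e i} := fun i =>
    Ideal.span_singleton_eq_span_singleton.2
      ((IsDiscreteValuationRing.associated_of_irreducible ℤ_[p] (hq i)
        PadicInt.irreducible_p).pow_pow)
  let d : ℕ+ →₀ ℕ := Finsupp.onFinset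
    ((Finset.univ.image e).preimage (fun r : ℕ+ => (r : ℕ)) PNat.coe_injective.injOn)
    (fun r => Fintype.card {i // e i = r}) (by
      intro r hr
      obtain ⟨⟨i, hi⟩⟩ := Fintype.card_pos_iff.1 (Nat.pos_of_ne_zero hr)
      simp only [Finset.mem_preimage, Finset.mem_image, Finset.mem_univ, true_and]
      exact ⟨i, hi⟩)
  have hd : ∀ r : ℕ+, d r = Fintype.card {i // e i = r} := fun r => rfl
  let b : ∀ r : ℕ+, Fin (d r) ≃ {i // e i = r} := fun r =>
    (finCongr (hd r)).trans (Fintype.equivFin _).symm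
  let c : ∀ (r : ℕ+) (j : {i // e i = r}),
      (ℤ_[p] ⧸ Ideal.span {q j.1 ^ e j.1}) ≃ₗ[ℤ_[p]] CyclicMod p r := fun r j =>
    Submodule.quotEquivOfEq _ _ (by rw [hspan j.1, j.2])
  let g : ((i : ι) → ℤ_[p] ⧸ Ideal.span {q i ^ e i}) →ₗ[ℤ_[p]]
      ((r : ℕ+) → Fin (d r) → CyclicMod p r) :=
    LinearMap.pi fun r => LinearMap.pi fun k =>
      (c r (b r k)).toLinearMap ∘ₗ LinearMap.proj (b r k).1
  have hbij : Function.Bijective g := by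
    constructor
    · rw [injective_iff_map_eq_zero]
      intro v hv
      funext i
      by_cases hi : e i = 0
      · have : Subsingleton (ℤ_[p] ⧸ Ideal.span {q i ^ e i}) := by
          rw [hi, pow_zero, Ideal.span_singleton_one]
          exact Ideal.Quotient.subsingleton_iff.2 rfl
        exact Subsingleton.elim _ _
      · obtain ⟨r, hr⟩ : ∃ r : ℕ+, e i = r := ⟨⟨e i, Nat.pos_of_ne_zero hi⟩, rfl⟩
        have h1 : ∀ j, c r j (v j.1) = 0 := by
          intro j
          obtain ⟨k, rfl⟩ := (b r).surjective j
          exact congrFun (congrFun hv r) k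
        exact (LinearEquiv.map_eq_zero_iff _).1 (h1 ⟨i, hr⟩)
    · intro w
      have h1 : ∀ i, ∃ y : ℤ_[p] ⧸ Ideal.span {q i ^ e i}, ∀ (r : ℕ+) (h : e i = r),
          c r ⟨i, h⟩ y = w r ((b r).symm ⟨i, h⟩) := by
        intro i
        by_cases hi : ∃ r : ℕ+, e i = r
        · obtain ⟨r, hr⟩ := hi
          refine ⟨(c r ⟨i, hr⟩).symm (w r ((b r).symm ⟨i, hr⟩)), fun r' h => ?_⟩
          obtain rfl : r = r' := PNat.eq (hr.symm.trans h)
          exact LinearEquiv.apply_symm_apply _ _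
        · exact ⟨0, fun r h => (hi ⟨r, h⟩).elim⟩
      choose v hv using h1
      refine ⟨v, ?_⟩
      funext r k
      refine (hv (b r k).1 r (b r k).2).trans ?_
      exact congrArg (w r) ((b r).symm_apply_apply k)
  exact ⟨n, d, ⟨f.trans (LinearEquiv.prodCongr (Finsupp.linearEquivFunOnFinite ℤ_[p] ℤ_[p] (Fin n))
    ((DirectSum.linearEquivFunOnFintype ℤ_[p] ι _).trans (LinearEquiv.ofBijective g hbij)))⟩⟩

/-!
The cokernels of `A + p x` are governed by a quadratic matrix polynomial. Diagonalise `A` modulo `p`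
and remove the invertible block by a Schur complement (`exists_quadratic_reduction`): then
`cok (A + p x) ≅ cok p F(x)`, where `F(x) = B + x C + p x² E` modulo `p²` for square matrices
`B, C, E`. All `F(x_i)` have the same size, which is the `p`-rank of every `H_i`, and the number of
parts `1` (resp. `1` or `2`) of `H_i` is the rank of `F(x_i)` modulo `p` (resp. the least rank of a
free module through which `F(x_i)` factors modulo `p²`; see `FactorsMod`).

*Necessity.* Modulo `p` the values of `F` at three points are linearly dependent, which gives the
triangle inequality (`MemC.triangle`) and hence the condition for `m = 3`. For `m = 4` let
`x_a` be one of the points, translated to `0`, and let `u_1, u_2, u_3` be the others. With Lagrange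
weights `c_m` that annihilate `u` and `u²`, the block matrix `∑ c_m (1, u_m)ᵗ F(u_m) (1, u_m Q_m)`
has `F(0)` as its first diagonal block, its off-diagonal blocks are divisible by `p`, and its second
diagonal block has left-invertible reduction, provided the `Q_m` solve `F(u_m) Q_m ≡ Y + u_m Z`
modulo `p` with `Z` injective modulo `p`. The pencil lemma `exists_submodule_pencil` supplies such
`Z` with as many columns as the rank of any chosen value `B + x₀ C` modulo `p`. Eliminating
(`FactorsMod.of_block`) yields `rank F(x_a) + rank_p F(x_i) ≤ ∑_{j ≠ a} rank F(x_j)` modulo `p`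
and modulo `p²` (`FactorsMod.of_pencil`, `MemC.four_points`), which are the two families of
inequalities.

*Sufficiency.* A matrix whose entries are polynomials in `y = p x`, made monic by adding a quartic
that vanishes at all `p x_i`, is realised by its block companion matrix
(`realizable_of_mem_polyValues`). Lagrange interpolation at the `p x_i` shows that multiples of
`p ^ (m - 1)` can be prescribed freely as values of such polynomials, and this produces elementary
tuples: scalar polynomials with prescribed zeros (`realizable_of_large`, `realizable_of_zeros`,
`realizable_linear`) and, for `m = 4`, two families of `2 × 2` matrices (`realizable_cubic_pair`,
`realizable_linear_pair`). Realisable tuples are closed under direct sums, and the numerical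
conditions say exactly that the tuple is a sum of elementary ones (`indicator_induction`,
`four_point_induction`).
-/

open scoped ENat

/-! ### Partitions and the modules they describe -/

/-- The element of `ℤ_p` attached to a part `e ∈ {0, 1, 2, …, ∞}`: it is `p ^ e`, and `0` for
`e = ∞`, so that `ℤ_p / (primePow p e)` is `ℤ / p ^ e` or `ℤ_p`. -/
noncomputable def primePow (p : ℕ) [Fact p.Prime] (e : ℕ∞) : ℤ_[p] :=
  if e = ⊤ then 0 else (p : ℤ_[p]) ^ e.toNat

/-- `H ≅ ∏ ℤ_p / (p ^ e)`, the product over the parts `e` of the multiset `t`; a part `∞` stands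
for a free summand `ℤ_p`. -/
def IsoParts (p : ℕ) [Fact p.Prime] (H : Type*) [AddCommGroup H] [Module ℤ_[p] H]
    (t : Multiset ℕ∞) : Prop :=
  ∃ (ι : Type) (_ : Fintype ι) (f : ι → ℕ∞), Finset.univ.val.map f = t ∧
    Nonempty (H ≃ₗ[ℤ_[p]] ((k : ι) → ℤ_[p] ⧸ Ideal.span {primePow p (f k)}))

section Parts

variable {p : ℕ} [Fact p.Prime]

theorem primePow_top : primePow p ⊤ = 0 := if_pos rfl

theorem primePow_coe (n : ℕ) : primePow p n = (p : ℤ_[p]) ^ n := by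
  simp [primePow]

theorem pow_dvd_primePow_iff (j : ℕ) (e : ℕ∞) :
    (p : ℤ_[p]) ^ j ∣ primePow p e ↔ (j : ℕ∞) ≤ e := by
  induction e using ENat.recTopCoe with
  | top => simp [primePow_top]
  | coe n =>
    rw [primePow_coe, pow_dvd_pow_iff (PadicInt.prime_p.ne_zero) PadicInt.prime_p.not_isUnit]
    simp

theorem primePow_dvd_pow_of_le {e : ℕ∞} {j : ℕ} (h : e ≤ j) :
    primePow p e ∣ (p : ℤ_[p]) ^ j := by
  lift e to ℕ using ne_top_of_le_ne_top (ENat.natCast_ne_top j) h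
  rw [primePow_coe]
  exact pow_dvd_pow _ (by simpa using h)

variable {H H' : Type*} [AddCommGroup H] [Module ℤ_[p] H] [AddCommGroup H'] [Module ℤ_[p] H']

/-- Two finite families with the same multiset of values differ by a reindexing. -/
theorem exists_equiv_of_map_eq {ι κ α : Type*} [Fintype ι] [Fintype κ] {f : ι → α} {g : κ → α}
    (h : Finset.univ.val.map f = Finset.univ.val.map g) : ∃ σ : ι ≃ κ, ∀ i, g (σ i) = f i := by
  classical
  have key : ∀ v, Nonempty ({i // f i = v} ≃ {k // g k = v}) := by
    intro v
    refine Fintype.card_eq.1 ?_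
    have := congrArg (Multiset.count v) h
    rw [Multiset.count_map, Multiset.count_map] at this
    rw [Fintype.card_subtype, Fintype.card_subtype]
    simpa [Finset.card, Finset.filter, eq_comm] using this
  have e := fun v => (key v).some
  refine ⟨(Equiv.sigmaFiberEquiv f).symm.trans
    ((Equiv.sigmaCongrRight e).trans (Equiv.sigmaFiberEquiv g)), fun i => ?_⟩
  exact (e (f i) ⟨i, rfl⟩).2

theorem IsoParts.congr {t : Multiset ℕ∞} (h : IsoParts p H t) (e : H' ≃ₗ[ℤ_[p]] H) :
    IsoParts p H' t := by
  obtain ⟨ι, _, f, hf, ⟨g⟩⟩ := h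
  exact ⟨ι, _, f, hf, ⟨e.trans g⟩⟩

theorem IsoParts.unique {t : Multiset ℕ∞} (h : IsoParts p H t) (h' : IsoParts p H' t) :
    Nonempty (H ≃ₗ[ℤ_[p]] H') := by
  obtain ⟨ι, _, f, hf, ⟨g⟩⟩ := h
  obtain ⟨ι', _, f', hf', ⟨g'⟩⟩ := h'
  obtain ⟨σ, hσ⟩ := exists_equiv_of_map_eq (hf.trans hf'.symm)
  obtain rfl : (fun i => f' (σ i)) = f := funext hσ
  exact ⟨g.trans ((LinearEquiv.piCongrLeft ℤ_[p]
    (fun k => ℤ_[p] ⧸ Ideal.span {primePow p (f' k)}) σ).trans g'.symm)⟩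

theorem IsoParts.prod {t t' : Multiset ℕ∞} (h : IsoParts p H t) (h' : IsoParts p H' t') :
    IsoParts p (H × H') (t + t') := by
  obtain ⟨ι, _, f, rfl, ⟨g⟩⟩ := h
  obtain ⟨ι', _, f', rfl, ⟨g'⟩⟩ := h'
  refine ⟨ι ⊕ ι', inferInstance, Sum.elim f f', ?_, ⟨(LinearEquiv.prodCongr g g').trans
    (LinearEquiv.sumPiEquivProdPi ℤ_[p] ι ι'
      (fun k => ℤ_[p] ⧸ Ideal.span {primePow p (Sum.elim f f' k)})).symm⟩⟩
  simp [← Finset.univ_disjSum_univ, Finset.disjSum, Multiset.disjSum]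

theorem IsoParts.of_subsingleton [Subsingleton H] : IsoParts p H 0 :=
  ⟨Empty, inferInstance, fun _ => 0, rfl, ⟨0, 0, fun _ => Subsingleton.elim _ _,
    fun _ => Subsingleton.elim _ _⟩⟩

/-- The decomposition recorded by `dInf` and `d`, as a partition without zero parts. -/
theorem exists_isoParts_of_hasType {dInf : ℕ} {d : ℕ+ →₀ ℕ} (h : HasType p H dInf d) :
    ∃ t : Multiset ℕ∞, 0 ∉ t ∧ IsoParts p H t ∧ ∀ r : ℕ+, t.count ((r : ℕ) : ℕ∞) = d r := by
  classical
  obtain ⟨g⟩ := h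
  have hfin : Finite (Σ r : ℕ+, Fin (d r)) := by
    refine Finite.of_injective
      (β := Σ r : d.support, Fin (d r))
      (fun a => ⟨⟨a.1, Finsupp.mem_support_iff.2 (Nat.ne_of_gt (a.2.pos))⟩, a.2⟩) ?_
    rintro ⟨r, a⟩ ⟨r', a'⟩ h
    simp only [Sigma.mk.injEq, Subtype.mk.injEq] at h
    obtain ⟨rfl, h⟩ := h
    simpa using h
  let _ : Fintype (Σ r : ℕ+, Fin (d r)) := Fintype.ofFinite _
  let f : Fin dInf ⊕ (Σ r : ℕ+, Fin (d r)) → ℕ∞ := Sum.elim (fun _ => ⊤) (fun a => ((a.1 : ℕ) : ℕ∞))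
  refine ⟨Finset.univ.val.map f, ?_, ⟨_, inferInstance, f, rfl, ⟨?_⟩⟩, ?_⟩
  · simp only [Multiset.mem_map, not_exists, not_and]
    rintro (a | a) -
    · simp [f]
    · simp [f]
  · let e1 : (Fin dInf → ℤ_[p]) ≃ₗ[ℤ_[p]]
        ((k : Fin dInf) → ℤ_[p] ⧸ Ideal.span {primePow p (f (Sum.inl k))}) :=
      LinearEquiv.piCongrRight fun k => (Submodule.quotEquivOfEqBot
        (Ideal.span {primePow p (f (Sum.inl k))})
        (Ideal.span_singleton_eq_bot.2 primePow_top)).symm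
    let e2 : ((r : ℕ+) → Fin (d r) → CyclicMod p r) ≃ₗ[ℤ_[p]]
        ((k : Σ r : ℕ+, Fin (d r)) → ℤ_[p] ⧸ Ideal.span {primePow p (f (Sum.inr k))}) :=
      (LinearEquiv.piCurry ℤ_[p] (fun (r : ℕ+) (_ : Fin (d r)) => CyclicMod p r)).symm.trans
        (LinearEquiv.piCongrRight fun k => Submodule.quotEquivOfEq _ _
          (by simp [f, primePow_coe]))
    exact g.trans ((LinearEquiv.prodCongr e1 e2).trans
      (LinearEquiv.sumPiEquivProdPi ℤ_[p] _ _
        (fun k => ℤ_[p] ⧸ Ideal.span {primePow p (f k)})).symm)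
  · intro r
    rw [Multiset.count_map]
    change (Finset.univ.filter fun a => ((r : ℕ) : ℕ∞) = f a).card = d r
    rw [← Fintype.card_subtype, ← Fintype.card_fin (d r)]
    refine Fintype.card_congr ⟨?_, fun a => ⟨Sum.inr ⟨r, a⟩, rfl⟩, ?_, ?_⟩
    · rintro ⟨a | ⟨r', a⟩, h⟩
      · simp [f] at h
      · have h' : r = r' := by simpa [f] using h
        exact h' ▸ a
    · rintro ⟨a | ⟨r', a⟩, h⟩
      · simp [f] at h
      · obtain rfl : r = r' := by simpa [f] using h
        rfl
    · intro a
      rfl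

theorem IsoParts.pRank_eq {t : Multiset ℕ∞} (h : IsoParts p H t) (h0 : 0 ∉ t) :
    pRank p H = t.card := by
  obtain ⟨ι, _, f, rfl, ⟨g⟩⟩ := h
  have hp : ∀ k, Ideal.span {primePow p (f k)} ≤ Ideal.span {(p : ℤ_[p])} := by
    intro k
    rw [Ideal.span_singleton_le_span_singleton]
    have : f k ≠ 0 := fun h => h0 (Multiset.mem_map.2 ⟨k, Finset.mem_univ_val k, h⟩)
    simpa using (pow_dvd_primePow_iff (p := p) 1 (f k)).2 (by
      simpa using Order.one_le_iff_pos.2 (pos_iff_ne_zero.2 this))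
  let q : ((k : ι) → ℤ_[p] ⧸ Ideal.span {primePow p (f k)}) →ₗ[ℤ_[p]]
      (ι → ℤ_[p] ⧸ Ideal.span {(p : ℤ_[p])}) :=
    LinearMap.pi fun k => (Submodule.factor (hp k)) ∘ₗ LinearMap.proj k
  have hq : Function.Surjective q := by
    intro w
    choose r hr using fun k => Submodule.Quotient.mk_surjective _ (w k)
    exact ⟨fun k => Submodule.Quotient.mk (r k), funext fun k => hr k⟩
  have hker : LinearMap.ker (q ∘ₗ g.toLinearMap) =
      Ideal.span {(p : ℤ_[p])} • (⊤ : Submodule ℤ_[p] H) := by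
    ext v
    rw [Submodule.ideal_span_singleton_smul, Submodule.mem_smul_pointwise_iff_exists]
    constructor
    · intro hv
      have h1 : ∀ k, ∃ r : ℤ_[p], g v k = Submodule.Quotient.mk ((p : ℤ_[p]) * r) := by
        intro k
        obtain ⟨s, hs⟩ := Submodule.Quotient.mk_surjective _ (g v k)
        have h2 : q (g v) k = 0 := congrFun (LinearMap.mem_ker.1 hv) k
        have h3 : (Submodule.Quotient.mk s : ℤ_[p] ⧸ Ideal.span {(p : ℤ_[p])}) = 0 := by
          rw [← h2]
          change _ = Submodule.factor (hp k) (g v k)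
          rw [← hs]
          rfl
        rw [Submodule.Quotient.mk_eq_zero, Ideal.mem_span_singleton] at h3
        obtain ⟨r, rfl⟩ := h3
        exact ⟨r, hs.symm⟩
      choose r hr using h1
      refine ⟨g.symm fun k => Submodule.Quotient.mk (r k), trivial, ?_⟩
      rw [← map_smul, LinearEquiv.symm_apply_eq]
      funext k
      rw [hr k]
      rfl
    · rintro ⟨w, -, rfl⟩
      rw [LinearMap.mem_ker, map_smul]
      funext k
      obtain ⟨s, hs⟩ := Submodule.Quotient.mk_surjective _ ((q ∘ₗ g.toLinearMap) w k)
      rw [Pi.smul_apply, ← hs, ← Submodule.Quotient.mk_smul, Pi.zero_apply,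
        Submodule.Quotient.mk_eq_zero, Ideal.mem_span_singleton]
      exact ⟨s, rfl⟩
  have e : (H ⧸ (Ideal.span {(p : ℤ_[p])} • (⊤ : Submodule ℤ_[p] H))) ≃ₗ[ℤ_[p]]
      (ι → ℤ_[p] ⧸ Ideal.span {(p : ℤ_[p])}) :=
    (Submodule.quotEquivOfEq _ _ hker.symm).trans
      (LinearMap.quotKerEquivOfSurjective _ (hq.comp g.surjective))
  have hs : Function.Surjective (algebraMap ℤ_[p] (ℤ_[p] ⧸ Ideal.span {(p : ℤ_[p])})) :=
    Ideal.Quotient.mk_surjective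
  have : Nontrivial (ℤ_[p] ⧸ Ideal.span {(p : ℤ_[p])}) :=
    Ideal.Quotient.nontrivial_iff.2 (by
      rw [Ne, Ideal.span_singleton_eq_top]; exact PadicInt.prime_p.not_isUnit)
  rw [pRank, (e.extendScalarsOfSurjective hs).finrank_eq, Module.finrank_fintype_fun_eq_card]
  simp

end Parts

/-! ### Reduction modulo `p` and modulo its powers -/

section Reduction

variable {p : ℕ} [Fact p.Prime]

theorem toZMod_eq_zero_iff (x : ℤ_[p]) : PadicInt.toZMod x = 0 ↔ (p : ℤ_[p]) ∣ x := by
  rw [← RingHom.mem_ker, PadicInt.ker_toZMod, PadicInt.maximalIdeal_eq_span_p,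
    Ideal.mem_span_singleton]

theorem toZMod_surjective : Function.Surjective (PadicInt.toZMod : ℤ_[p] →+* ZMod p) :=
  ZMod.ringHom_surjective _

theorem isUnit_iff_toZMod_ne_zero (x : ℤ_[p]) : IsUnit x ↔ PadicInt.toZMod x ≠ 0 := by
  rw [Ne, toZMod_eq_zero_iff, ← Ideal.mem_span_singleton, ← PadicInt.maximalIdeal_eq_span_p,
    IsLocalRing.notMem_maximalIdeal]

theorem coe_p_ne_zero : (p : ℤ_[p]) ≠ 0 := PadicInt.prime_p.ne_zero

/-- A linear map on a free module whose values are all multiples of `c` is a multiple of `c`. -/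
theorem LinearMap.exists_eq_smul_of_forall {R V W : Type*} [CommRing R] [AddCommGroup V]
    [Module R V] [Module.Free R V] [AddCommGroup W] [Module R W] (f : V →ₗ[R] W) (c : R)
    (h : ∀ v, ∃ w, f v = c • w) : ∃ g : V →ₗ[R] W, f = c • g := by
  choose w hw using h
  let b := Module.Free.chooseBasis R V
  refine ⟨b.constr R fun i => w (b i), b.ext fun i => ?_⟩
  rw [hw, LinearMap.smul_apply, b.constr_basis]

/-- An endomorphism congruent to the identity modulo `p` is bijective, by Nakayama's lemma. -/
theorem bijective_of_eq_one_add_smul {M : Type*} [AddCommGroup M] [Module ℤ_[p] M]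
    [Module.Finite ℤ_[p] M] (f g : M →ₗ[ℤ_[p]] M) (h : ∀ v, f v = v + (p : ℤ_[p]) • g v) :
    Function.Bijective f := by
  refine OrzechProperty.bijective_of_surjective_endomorphism f ?_
  rw [← LinearMap.range_eq_top, eq_top_iff]
  refine Submodule.le_of_le_smul_of_le_jacobson_bot (I := IsLocalRing.maximalIdeal ℤ_[p])
    Module.Finite.fg_top (IsLocalRing.maximalIdeal_le_jacobson _) ?_
  intro v _
  have : v = f v + (p : ℤ_[p]) • (-g v) := by rw [h]; module
  rw [this]
  refine Submodule.add_mem_sup (LinearMap.mem_range_self f v) (Submodule.smul_mem_smul ?_ trivial)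
  rw [PadicInt.maximalIdeal_eq_span_p]
  exact Ideal.mem_span_singleton_self _

/-! ### Surjections onto `(ℤ / p ^ j) ^ l` count the parts that are at least `j` -/

variable {H : Type*} [AddCommGroup H] [Module ℤ_[p] H]

theorem IsoParts.exists_surjective {t : Multiset ℕ∞} (h : IsoParts p H t) (j : ℕ) :
    ∃ φ : H →ₗ[ℤ_[p]] (Fin (t.countP fun e => (j : ℕ∞) ≤ e) →
      ℤ_[p] ⧸ Ideal.span {(p : ℤ_[p]) ^ j}), Function.Surjective φ := by
  classical
  obtain ⟨ι, _, f, rfl, ⟨g⟩⟩ := h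
  have hcard : (Multiset.map f Finset.univ.val).countP (fun e => (j : ℕ∞) ≤ e) =
      Fintype.card {k // (j : ℕ∞) ≤ f k} := by
    rw [Multiset.countP_map, Fintype.card_subtype]
    rfl
  rw [hcard]
  let σ : Fin (Fintype.card {k // (j : ℕ∞) ≤ f k}) ≃ {k // (j : ℕ∞) ≤ f k} :=
    (Fintype.equivFin _).symm
  have hp : ∀ a, Ideal.span {primePow p (f (σ a))} ≤ Ideal.span {(p : ℤ_[p]) ^ j} := fun a =>
    Ideal.span_singleton_le_span_singleton.2 ((pow_dvd_primePow_iff _ _).2 (σ a).2)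
  let ψ : ((k : ι) → ℤ_[p] ⧸ Ideal.span {primePow p (f k)}) →ₗ[ℤ_[p]]
      (Fin (Fintype.card {k // (j : ℕ∞) ≤ f k}) → ℤ_[p] ⧸ Ideal.span {(p : ℤ_[p]) ^ j}) :=
    LinearMap.pi fun a => Submodule.factor (hp a) ∘ₗ LinearMap.proj (σ a).1
  suffices hψ : Function.Surjective ψ from ⟨ψ ∘ₗ g.toLinearMap, hψ.comp g.surjective⟩
  intro w
  choose r hr using fun a => Submodule.Quotient.mk_surjective _ (w a)
  refine ⟨fun k => if hk : (j : ℕ∞) ≤ f k then Submodule.Quotient.mk (r (σ.symm ⟨k, hk⟩)) else 0,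
    funext fun a => ?_⟩
  rw [LinearMap.pi_apply, LinearMap.comp_apply, LinearMap.proj_apply, dif_pos (σ a).2,
    Subtype.coe_eta, Equiv.symm_apply_apply, ← hr a]
  rfl

/-- Modulo `p` the target is spanned by the images of the generators whose part is at least `j`:
the other generators are killed by `p ^ (j - 1)`, so their images are divisible by `p`. -/
theorem IsoParts.le_countP_of_surjective {t : Multiset ℕ∞} (h : IsoParts p H t) {j l : ℕ}
    (φ : H →ₗ[ℤ_[p]] (Fin l → ℤ_[p] ⧸ Ideal.span {(p : ℤ_[p]) ^ (j + 1)}))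
    (hφ : Function.Surjective φ) : l ≤ t.countP fun e => ((j + 1 : ℕ) : ℕ∞) ≤ e := by
  classical
  obtain ⟨ι, _, f, rfl, ⟨g⟩⟩ := h
  have hcard : (Multiset.map f Finset.univ.val).countP (fun e => ((j + 1 : ℕ) : ℕ∞) ≤ e) =
      Fintype.card {k // ((j + 1 : ℕ) : ℕ∞) ≤ f k} := by
    rw [Multiset.countP_map, Fintype.card_subtype]
    rfl
  rw [hcard]
  let E : (ι → ℤ_[p]) →ₗ[ℤ_[p]] H :=
    g.symm.toLinearMap ∘ₗ LinearMap.pi fun k => Submodule.mkQ _ ∘ₗ LinearMap.proj k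
  have hE : Function.Surjective E := by
    refine g.symm.surjective.comp fun v => ?_
    choose r hr using fun k => Submodule.Quotient.mk_surjective _ (v k)
    exact ⟨r, funext hr⟩
  have hE0 : ∀ k, primePow p (f k) • E (Pi.single k 1) = 0 := by
    intro k
    rw [← map_smul]
    change g.symm _ = 0
    rw [LinearEquiv.map_eq_zero_iff]
    funext k'
    change (Submodule.Quotient.mk _ : ℤ_[p] ⧸ Ideal.span {primePow p (f k')}) = 0
    rw [Submodule.Quotient.mk_eq_zero, Ideal.mem_span_singleton]
    by_cases hk : k = k'
    · subst hk
      simp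
    · simp [Ne.symm hk]
  choose w hw using fun (k : ι) (a : Fin l) =>
    Submodule.Quotient.mk_surjective _ (φ (E (Pi.single k 1)) a)
  have hw0 : ∀ k, ¬ ((j + 1 : ℕ) : ℕ∞) ≤ f k → ∀ a, PadicInt.toZMod (w k a) = 0 := by
    intro k hk a
    have h1 : f k ≤ j := by
      rw [not_le] at hk
      exact Order.lt_add_one_iff_of_not_isMax (by simp) |>.1 (by simpa using hk)
    have h2 : (p : ℤ_[p]) ^ j • E (Pi.single k 1) = 0 := by
      obtain ⟨c, hc⟩ := primePow_dvd_pow_of_le (p := p) h1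
      rw [hc, mul_comm, mul_smul, hE0, smul_zero]
    have h3 : (p : ℤ_[p]) ^ j • φ (E (Pi.single k 1)) a = 0 := by
      rw [← Pi.smul_apply, ← map_smul, h2, map_zero, Pi.zero_apply]
    rw [← hw k a, ← Submodule.Quotient.mk_smul, Submodule.Quotient.mk_eq_zero,
      Ideal.mem_span_singleton, pow_succ, smul_eq_mul] at h3
    exact (toZMod_eq_zero_iff _).2 ((mul_dvd_mul_iff_left (pow_ne_zero j coe_p_ne_zero)).1 h3)
  let s : {k // ((j + 1 : ℕ) : ℕ∞) ≤ f k} → (Fin l → ZMod p) := fun k a =>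
    PadicInt.toZMod (w k a)
  have hs : Submodule.span (ZMod p) (Set.range s) = ⊤ := by
    rw [eq_top_iff]
    intro u _
    choose r hr using fun a => toZMod_surjective (u a)
    obtain ⟨x, hx⟩ := hφ fun a => Submodule.Quotient.mk (r a)
    obtain ⟨c, rfl⟩ := hE x
    have hc : c = ∑ k, c k • Pi.single k (1 : ℤ_[p]) := by
      funext k'
      simp [Finset.sum_apply, Pi.single_apply]
    have hu : u = ∑ k, PadicInt.toZMod (c k) • fun a => PadicInt.toZMod (w k a) := by
      funext a
      have h4 : (Submodule.Quotient.mk (∑ k, c k • w k a) :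
          ℤ_[p] ⧸ Ideal.span {(p : ℤ_[p]) ^ (j + 1)}) = Submodule.Quotient.mk (r a) := by
        rw [← congrFun hx a, hc, map_sum, map_sum, Finset.sum_apply, ← Submodule.mkQ_apply,
          map_sum]
        refine Finset.sum_congr rfl fun k _ => ?_
        rw [map_smul, map_smul, map_smul, Submodule.mkQ_apply, hw, Pi.smul_apply]
        simp [Finset.sum_apply, Pi.single_apply]
      rw [Submodule.Quotient.eq, Ideal.mem_span_singleton] at h4
      have h5 := (toZMod_eq_zero_iff _).2 ((dvd_pow_self (p : ℤ_[p]) (Nat.succ_ne_zero j)).trans h4)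
      rw [map_sub, sub_eq_zero, hr] at h5
      rw [← h5, map_sum, Finset.sum_apply]
      simp
    rw [hu]
    refine Submodule.sum_mem _ fun k _ => Submodule.smul_mem _ _ ?_
    by_cases hk : ((j + 1 : ℕ) : ℕ∞) ≤ f k
    · exact Submodule.subset_span ⟨⟨k, hk⟩, rfl⟩
    · convert Submodule.zero_mem _
      exact hw0 k hk _
  have := finrank_range_le_card (R := ZMod p) s
  rw [Set.finrank, hs, finrank_top, Module.finrank_fintype_fun_eq_card, Fintype.card_fin] at this
  exact this

end Reduction

/-! ### Factorisations modulo a power of `p` -/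

/-- Modulo `q`, the map `f` factors through a free module of rank `k`. For `q = p ^ j` the least
such `k` is the number of elementary divisors of `f` that are not divisible by `p ^ j`. -/
def FactorsMod {p : ℕ} [Fact p.Prime] {V W : Type*} [AddCommGroup V] [Module ℤ_[p] V]
    [AddCommGroup W] [Module ℤ_[p] W] (q : ℤ_[p]) (f : V →ₗ[ℤ_[p]] W) (k : ℕ) : Prop :=
  ∃ (g : V →ₗ[ℤ_[p]] (Fin k → ℤ_[p])) (h : (Fin k → ℤ_[p]) →ₗ[ℤ_[p]] W) (e : V →ₗ[ℤ_[p]] W),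
    f = h ∘ₗ g + q • e

section FactorsMod

variable {p : ℕ} [Fact p.Prime]
  {V W V' W' K : Type*} [AddCommGroup V] [Module ℤ_[p] V] [AddCommGroup W] [Module ℤ_[p] W]
  [AddCommGroup V'] [Module ℤ_[p] V'] [AddCommGroup W'] [Module ℤ_[p] W']
  [AddCommGroup K] [Module ℤ_[p] K]

theorem FactorsMod.of_free [Module.Free ℤ_[p] K] [Module.Finite ℤ_[p] K] {q : ℤ_[p]} {k : ℕ}
    (hk : Module.finrank ℤ_[p] K = k) {f : V →ₗ[ℤ_[p]] W} (g : V →ₗ[ℤ_[p]] K)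
    (h : K →ₗ[ℤ_[p]] W) (e : V →ₗ[ℤ_[p]] W) (hf : ∀ v, f v = h (g v) + q • e v) :
    FactorsMod q f k := by
  subst hk
  let b := (Module.finBasis ℤ_[p] K).equivFun
  refine ⟨b.toLinearMap ∘ₗ g, h ∘ₗ b.symm.toLinearMap, e, LinearMap.ext fun v => ?_⟩
  simp [hf]

theorem FactorsMod.comp {q : ℤ_[p]} {k : ℕ} {f : V →ₗ[ℤ_[p]] W} (hf : FactorsMod q f k)
    (a : W →ₗ[ℤ_[p]] W') (b : V' →ₗ[ℤ_[p]] V) : FactorsMod q (a ∘ₗ f ∘ₗ b) k := by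
  obtain ⟨g, h, e, rfl⟩ := hf
  refine ⟨g ∘ₗ b, a ∘ₗ h, a ∘ₗ e ∘ₗ b, LinearMap.ext fun v => ?_⟩
  simp

theorem FactorsMod.add {q : ℤ_[p]} {k k' : ℕ} {f f' : V →ₗ[ℤ_[p]] W} (hf : FactorsMod q f k)
    (hf' : FactorsMod q f' k') : FactorsMod q (f + f') (k + k') := by
  obtain ⟨g, h, e, rfl⟩ := hf
  obtain ⟨g', h', e', rfl⟩ := hf'
  refine FactorsMod.of_free (K := (Fin k → ℤ_[p]) × (Fin k' → ℤ_[p])) (by simp) (g.prod g')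
    (h.coprod h') (e + e') fun v => ?_
  simp
  abel

theorem FactorsMod.congr {q : ℤ_[p]} {k : ℕ} {f f' : V →ₗ[ℤ_[p]] W} (hf : FactorsMod q f k)
    (c : V →ₗ[ℤ_[p]] W) (h : ∀ v, f' v = f v + q • c v) : FactorsMod q f' k := by
  obtain ⟨g, h', e, rfl⟩ := hf
  refine ⟨g, h', e + c, LinearMap.ext fun v => ?_⟩
  simp [h]
  abel

/-- If `L ∘ σ` is bijective on `ℤ_p ^ l`, then the complementary projection
`1 - σ (L σ)⁻¹ L` factors through the kernel of `L`, which is free of corank `l`. -/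
theorem exists_complement [Module.Free ℤ_[p] V] [Module.Finite ℤ_[p] V] {l : ℕ}
    (L : V →ₗ[ℤ_[p]] (Fin l → ℤ_[p])) (σ : (Fin l → ℤ_[p]) →ₗ[ℤ_[p]] V)
    (h : Function.Bijective (L ∘ₗ σ)) :
    ∃ k, k + l = Module.finrank ℤ_[p] V ∧
      ∃ (g : V →ₗ[ℤ_[p]] (Fin k → ℤ_[p])) (ι : (Fin k → ℤ_[p]) →ₗ[ℤ_[p]] V)
        (T : (Fin l → ℤ_[p]) →ₗ[ℤ_[p]] (Fin l → ℤ_[p])),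
        ∀ v, v = ι (g v) + σ (T (L v)) := by
  let T := (LinearEquiv.ofBijective (L ∘ₗ σ) h).symm
  have hT : ∀ u, L (σ (T u)) = u := fun u =>
    (LinearEquiv.ofBijective (L ∘ₗ σ) h).apply_symm_apply u
  have hsurj : Function.Surjective L := fun u => ⟨σ (T u), hT u⟩
  let g : V →ₗ[ℤ_[p]] LinearMap.ker L :=
    LinearMap.codRestrict _ (LinearMap.id - σ ∘ₗ T.toLinearMap ∘ₗ L) fun v => by
      simp [LinearMap.mem_ker, hT]
  let b := (Module.finBasis ℤ_[p] (LinearMap.ker L)).equivFun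
  refine ⟨Module.finrank ℤ_[p] (LinearMap.ker L), ?_, b.toLinearMap ∘ₗ g,
    (LinearMap.ker L).subtype ∘ₗ b.symm.toLinearMap, T.toLinearMap, fun v => ?_⟩
  · have h1 := (LinearMap.ker L).finrank_quotient_add_finrank
    have h2 := (LinearMap.quotKerEquivOfSurjective L hsurj).finrank_eq
    rw [Module.finrank_fintype_fun_eq_card, Fintype.card_fin] at h2
    omega
  · simp [g]

/-- Splitting off a surjection of the cokernel of `p F` onto `(ℤ / p ^ (j + 1)) ^ l` shows that
`F` factors modulo `p ^ j` through a module of corank `l`. -/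
theorem factorsMod_of_surjective [Module.Free ℤ_[p] V] [Module.Finite ℤ_[p] V] {j l : ℕ}
    (F : V →ₗ[ℤ_[p]] V)
    (φ : (V ⧸ LinearMap.range ((p : ℤ_[p]) • F)) →ₗ[ℤ_[p]]
      (Fin l → ℤ_[p] ⧸ Ideal.span {(p : ℤ_[p]) ^ (j + 1)})) (hφ : Function.Surjective φ) :
    ∃ k, k + l = Module.finrank ℤ_[p] V ∧ FactorsMod ((p : ℤ_[p]) ^ j) F k := by
  let π : (Fin l → ℤ_[p]) →ₗ[ℤ_[p]] (Fin l → ℤ_[p] ⧸ Ideal.span {(p : ℤ_[p]) ^ (j + 1)}) :=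
    LinearMap.pi fun a => Submodule.mkQ _ ∘ₗ LinearMap.proj a
  have hπ : Function.Surjective π := by
    intro w
    choose r hr using fun a => Submodule.Quotient.mk_surjective _ (w a)
    exact ⟨r, funext hr⟩
  have hπ0 : ∀ u, π u = 0 → ∀ a, (p : ℤ_[p]) ^ (j + 1) ∣ u a := by
    intro u hu a
    have : (Submodule.Quotient.mk (u a) : ℤ_[p] ⧸ Ideal.span {(p : ℤ_[p]) ^ (j + 1)}) = 0 :=
      congrFun hu a
    rwa [Submodule.Quotient.mk_eq_zero, Ideal.mem_span_singleton] at this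
  obtain ⟨L, hL⟩ := Module.projective_lifting_property π (φ ∘ₗ Submodule.mkQ _) hπ
  obtain ⟨σ, hσ⟩ := Module.projective_lifting_property (φ ∘ₗ Submodule.mkQ _) π
    (hφ.comp (Submodule.mkQ_surjective _))
  let D : (Fin l → ℤ_[p]) →ₗ[ℤ_[p]] (Fin l → ℤ_[p]) := L ∘ₗ σ - LinearMap.id
  have h1 : ∀ u, ∃ w, D u = (p : ℤ_[p]) • w := by
    intro u
    have h2 : π (D u) = 0 := by
      rw [LinearMap.sub_apply, map_sub, LinearMap.comp_apply, ← LinearMap.comp_apply π, hL,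
        ← LinearMap.comp_apply, hσ, LinearMap.id_apply, sub_self]
    choose w hw using hπ0 _ h2
    refine ⟨fun a => (p : ℤ_[p]) ^ j * w a, funext fun a => ?_⟩
    rw [hw a, Pi.smul_apply, smul_eq_mul]
    ring
  obtain ⟨N, hN⟩ := LinearMap.exists_eq_smul_of_forall _ _ h1
  have hbij : Function.Bijective (L ∘ₗ σ) := bijective_of_eq_one_add_smul _ N fun v => by
    have := LinearMap.congr_fun hN v
    rw [LinearMap.sub_apply, LinearMap.id_apply, sub_eq_iff_eq_add, LinearMap.smul_apply] at this
    rw [this, add_comm]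
  have h3 : ∀ v, ∃ w, (L ∘ₗ F) v = (p : ℤ_[p]) ^ j • w := by
    intro v
    have h5 : Submodule.mkQ (LinearMap.range ((p : ℤ_[p]) • F)) ((p : ℤ_[p]) • F v) = 0 :=
      (Submodule.Quotient.mk_eq_zero _).2 ⟨v, rfl⟩
    have h4 : π (L ((p : ℤ_[p]) • F v)) = 0 := by
      rw [← LinearMap.comp_apply π, hL, LinearMap.comp_apply, h5, map_zero]
    choose w hw using hπ0 _ h4
    refine ⟨w, funext fun a => ?_⟩
    have := hw a
    rw [map_smul, Pi.smul_apply, smul_eq_mul, pow_succ', mul_assoc] at this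
    exact mul_left_cancel₀ coe_p_ne_zero this
  obtain ⟨M, hM⟩ := LinearMap.exists_eq_smul_of_forall _ _ h3
  obtain ⟨k, hk, g, ι, T, hT⟩ := exists_complement L σ hbij
  refine ⟨k, hk, g ∘ₗ F, ι, σ ∘ₗ T ∘ₗ M, LinearMap.ext fun v => ?_⟩
  have := LinearMap.congr_fun hM v
  rw [LinearMap.comp_apply, LinearMap.smul_apply] at this
  conv_lhs => rw [hT (F v), this]
  simp

/-- A factorisation of `F` modulo `p ^ j` through rank `k` bounds below the number of parts of the
cokernel of `p F` that exceed `j`: this cokernel maps onto the reduction modulo `p ^ (j + 1)` of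
the free part of the cokernel of the second factor. -/
theorem FactorsMod.finrank_le [Module.Free ℤ_[p] V] [Module.Finite ℤ_[p] V] {j k : ℕ}
    {F : V →ₗ[ℤ_[p]] V} (hF : FactorsMod ((p : ℤ_[p]) ^ j) F k) {t : Multiset ℕ∞}
    (ht : IsoParts p (V ⧸ LinearMap.range ((p : ℤ_[p]) • F)) t) :
    Module.finrank ℤ_[p] V ≤ k + t.countP fun e => ((j + 1 : ℕ) : ℕ∞) ≤ e := by
  obtain ⟨g, h, e, rfl⟩ := hF
  let Q := V ⧸ LinearMap.range h
  let Q' := Q ⧸ Submodule.torsion ℤ_[p] Q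
  have hQ' : Module.finrank ℤ_[p] Q' = Module.finrank ℤ_[p] Q :=
    finrank_quotient_eq_of_le_torsion le_rfl
  have hQ : Module.finrank ℤ_[p] V ≤ k + Module.finrank ℤ_[p] Q := by
    have h1 := (LinearMap.range h).finrank_quotient_add_finrank
    have h2 := LinearMap.finrank_range_le h
    rw [Module.finrank_fintype_fun_eq_card, Fintype.card_fin] at h2
    change Module.finrank ℤ_[p] Q + _ = _ at h1
    omega
  let b : Q' ≃ₗ[ℤ_[p]] (Fin (Module.finrank ℤ_[p] Q') → ℤ_[p]) :=
    (Module.finBasis ℤ_[p] Q').equivFun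
  let π : (Fin (Module.finrank ℤ_[p] Q') → ℤ_[p]) →ₗ[ℤ_[p]]
      (Fin (Module.finrank ℤ_[p] Q') → ℤ_[p] ⧸ Ideal.span {(p : ℤ_[p]) ^ (j + 1)}) :=
    LinearMap.pi fun a => Submodule.mkQ _ ∘ₗ LinearMap.proj a
  have hπ : Function.Surjective π := by
    intro w
    choose r hr using fun a => Submodule.Quotient.mk_surjective _ (w a)
    exact ⟨r, funext hr⟩
  let ψ : V →ₗ[ℤ_[p]]
      (Fin (Module.finrank ℤ_[p] Q') → ℤ_[p] ⧸ Ideal.span {(p : ℤ_[p]) ^ (j + 1)}) :=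
    π ∘ₗ b.toLinearMap ∘ₗ Submodule.mkQ _ ∘ₗ Submodule.mkQ _
  have hψ : Function.Surjective ψ :=
    hπ.comp (b.surjective.comp ((Submodule.mkQ_surjective _).comp (Submodule.mkQ_surjective _)))
  have hψh : ∀ u, ψ (h u) = 0 := by
    intro u
    have : (Submodule.mkQ (LinearMap.range h)) (h u) = 0 :=
      (Submodule.Quotient.mk_eq_zero _).2 ⟨u, rfl⟩
    simp only [ψ, LinearMap.comp_apply]
    erw [this]
    simp
  have hψp : ∀ v, (p : ℤ_[p]) ^ (j + 1) • ψ v = 0 := by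
    intro v
    funext a
    obtain ⟨s, hs⟩ := Submodule.Quotient.mk_surjective _ (ψ v a)
    rw [Pi.smul_apply, ← hs, ← Submodule.Quotient.mk_smul, Pi.zero_apply,
      Submodule.Quotient.mk_eq_zero, Ideal.mem_span_singleton]
    exact ⟨s, rfl⟩
  have hker : LinearMap.range ((p : ℤ_[p]) • (h ∘ₗ g + (p : ℤ_[p]) ^ j • e)) ≤
      LinearMap.ker ψ := by
    rintro _ ⟨v, rfl⟩
    have : ((p : ℤ_[p]) • (h ∘ₗ g + (p : ℤ_[p]) ^ j • e)) v =
        h ((p : ℤ_[p]) • g v) + (p : ℤ_[p]) ^ (j + 1) • e v := by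
      simp only [LinearMap.smul_apply, LinearMap.add_apply, LinearMap.comp_apply, map_smul]
      module
    rw [LinearMap.mem_ker, this, map_add, hψh, zero_add, map_smul, hψp]
  have := ht.le_countP_of_surjective (Submodule.liftQ _ ψ hker) (by
    intro w
    obtain ⟨v, hv⟩ := hψ w
    exact ⟨Submodule.Quotient.mk v, hv⟩)
  omega

end FactorsMod

/-! ### Rank inequalities for pencils -/

/-- For a pencil `B + x C` over a field there is a subspace `Z`, at least as large as the range of
any member of the pencil, such that for `z ∈ Z` and suitable `y` the vector `y + x z` lies in the
range of `B + x C` for all `x` in a prescribed set. For a pencil without infinite elementary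
divisors `Z = range C` would do; in general one adds `B W`, where `W` consists of the `w` with
`x B w ∈ range (B + x C)` for all these `x`. -/
theorem exists_submodule_pencil_zero {k U : Type*} [Field k] [AddCommGroup U] [Module k U]
    [FiniteDimensional k U] (B C : U →ₗ[k] U) (X : Set k) :
    ∃ Z : Submodule k U, Module.finrank k (LinearMap.range B) ≤ Module.finrank k Z ∧
      ∀ z ∈ Z, ∃ y, ∀ x ∈ X, y + x • z ∈ LinearMap.range (B + x • C) := by
  let W : Submodule k U := ⨅ x ∈ X, (LinearMap.range (B + x • C)).comap (x • B)
  have hW : ∀ w, w ∈ W ↔ ∀ x ∈ X, x • B w ∈ LinearMap.range (B + x • C) := by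
    intro w
    simp [W, Submodule.mem_iInf]
  have hWC : ∀ w ∈ W, ∀ s, C s = B w → s ∈ W := by
    intro w hw s hs
    refine (hW s).2 fun x hx => ?_
    have h1 : x • B s = (B + x • C) (x • s) - x • x • B w := by
      simp [← hs]
    rw [h1]
    exact Submodule.sub_mem _ (LinearMap.mem_range_self _ _)
      (Submodule.smul_mem _ _ ((hW w).1 hw x hx))
  obtain ⟨W', hW'⟩ := Submodule.exists_isCompl W
  have hinj : ∀ s ∈ W', ∀ w ∈ W, C s = B w → s = 0 := fun s hs w hw h =>
    Submodule.disjoint_def.1 hW'.disjoint s (hWC w hw s h) hs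
  refine ⟨W.map B ⊔ LinearMap.range C, ?_, ?_⟩
  · have h1 : Module.finrank k (LinearMap.range B) ≤
        Module.finrank k (W.map B) + Module.finrank k W' := by
      rw [← Submodule.map_top, ← hW'.sup_eq_top, Submodule.map_sup]
      exact (Submodule.finrank_add_le_finrank_add_finrank _ _).trans
        (Nat.add_le_add_left (Submodule.finrank_map_le _ _) _)
    have h2 : Module.finrank k (W'.map C) = Module.finrank k W' := by
      rw [← LinearMap.range_domRestrict]
      refine LinearMap.finrank_range_of_inj ((injective_iff_map_eq_zero _).2 fun s hs => ?_)
      exact Subtype.ext (hinj s s.2 0 (Submodule.zero_mem _) (by simpa using hs))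
    have h3 : W.map B ⊓ W'.map C = ⊥ := by
      rw [eq_bot_iff]
      rintro _ ⟨⟨w, hw, rfl⟩, ⟨s, hs, h⟩⟩
      rw [← h, hinj s hs w hw h, map_zero]
      exact Submodule.zero_mem _
    have h4 := Submodule.finrank_sup_add_finrank_inf_eq (W.map B) (W'.map C)
    rw [h3, finrank_bot, h2] at h4
    have h5 : Module.finrank k ↥(W.map B ⊔ W'.map C) ≤
        Module.finrank k ↥(W.map B ⊔ LinearMap.range C) :=
      Submodule.finrank_mono (sup_le_sup_left (LinearMap.map_le_range) _)
    omega
  · intro z hz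
    obtain ⟨_, ⟨w, hw, rfl⟩, _, ⟨s, rfl⟩, rfl⟩ := Submodule.mem_sup.1 hz
    refine ⟨B s, fun x hx => ?_⟩
    have h1 : B s + x • (B w + C s) = (B + x • C) s + x • B w := by
      simp; abel
    rw [h1]
    exact Submodule.add_mem _ (LinearMap.mem_range_self _ _) ((hW w).1 hw x hx)

theorem exists_submodule_pencil {k U : Type*} [Field k] [AddCommGroup U] [Module k U]
    [FiniteDimensional k U] (B C : U →ₗ[k] U) (X : Set k) (x₀ : k) :
    ∃ Z : Submodule k U,
      Module.finrank k (LinearMap.range (B + x₀ • C)) ≤ Module.finrank k Z ∧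
      ∀ z ∈ Z, ∃ y, ∀ x ∈ X, y + x • z ∈ LinearMap.range (B + x • C) := by
  obtain ⟨Z, hZ, h⟩ := exists_submodule_pencil_zero (B + x₀ • C) C ((fun x => x - x₀) '' X)
  refine ⟨Z, hZ, fun z hz => ?_⟩
  obtain ⟨y, hy⟩ := h z hz
  refine ⟨y - x₀ • z, fun x hx => ?_⟩
  have h₁ : y - x₀ • z + x • z = y + (x - x₀) • z := by module
  have h₂ : B + x • C = B + x₀ • C + (x - x₀) • C := by module
  rw [h₁, h₂]
  exact hy _ ⟨x, hx, rfl⟩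

section Key

variable {p : ℕ} [Fact p.Prime]
  {V W : Type*} [AddCommGroup V] [Module ℤ_[p] V] [AddCommGroup W] [Module ℤ_[p] W]

theorem FactorsMod.of_forall [Module.Free ℤ_[p] V] {q : ℤ_[p]} {k : ℕ} {f : V →ₗ[ℤ_[p]] W}
    (g : V →ₗ[ℤ_[p]] (Fin k → ℤ_[p])) (h : (Fin k → ℤ_[p]) →ₗ[ℤ_[p]] W)
    (hf : ∀ v, ∃ w, f v = h (g v) + q • w) : FactorsMod q f k := by
  obtain ⟨e, he⟩ := LinearMap.exists_eq_smul_of_forall (f - h ∘ₗ g) q (fun v => by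
    obtain ⟨w, hw⟩ := hf v
    exact ⟨w, by simp [hw]⟩)
  exact ⟨g, h, e, by rw [← he]; abel⟩

/-- Block elimination. Let `F_m` factor modulo `q` through rank `k_m`. The block matrix
`∑ c_m (1, u_m)ᵗ F_m (1, u_m Q_m)` then factors through rank `∑ k_m`. If its diagonal blocks are
`A` modulo `q` and `Z` modulo `p`, with `Z` left invertible modulo `p`, and its off-diagonal blocks
are divisible by `p`, then clearing them changes `A` only modulo `p ^ 2`. -/
theorem FactorsMod.of_block [Module.Free ℤ_[p] V] [Module.Finite ℤ_[p] V] {j l : ℕ} (hj : 1 ≤ j)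
    (hj' : j ≤ 2) {F : Fin 3 → V →ₗ[ℤ_[p]] V} {k : Fin 3 → ℕ}
    (hF : ∀ m, FactorsMod ((p : ℤ_[p]) ^ j) (F m) (k m)) (A : V →ₗ[ℤ_[p]] V)
    (c u : Fin 3 → ℤ_[p]) (Q : Fin 3 → (Fin l → ℤ_[p]) →ₗ[ℤ_[p]] V)
    (Z : (Fin l → ℤ_[p]) →ₗ[ℤ_[p]] V) (ρ : V →ₗ[ℤ_[p]] (Fin l → ℤ_[p]))
    (h₁ : ∀ v, ∃ w, A v = ∑ m, c m • F m v + (p : ℤ_[p]) ^ j • w)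
    (h₂ : ∀ v, ∃ w, ∑ m, (c m * u m) • F m v = (p : ℤ_[p]) • w)
    (h₃ : ∀ a, ∃ w, ∑ m, (c m * u m) • F m (Q m a) = (p : ℤ_[p]) • w)
    (h₄ : ∀ a, ∃ w, ∑ m, (c m * u m * u m) • F m (Q m a) = Z a + (p : ℤ_[p]) • w)
    (hρ : ∀ a, ∃ w, ρ (Z a) = a + (p : ℤ_[p]) • w) :
    ∃ k', k' + l = ∑ m, k m ∧ FactorsMod ((p : ℤ_[p]) ^ j) A k' := by
  obtain ⟨i, rfl⟩ : ∃ i, j = i + 1 := ⟨j - 1, by omega⟩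
  choose g h e hF using hF
  have hs : ∀ (c : Fin 3 → ℤ_[p]) (v : Fin 3 → V), ∑ m, c m • h m (g m (v m)) =
      ∑ m, c m • F m (v m) - (p : ℤ_[p]) ^ (i + 1) • ∑ m, c m • e m (v m) := by
    intro c v
    rw [Finset.smul_sum, ← Finset.sum_sub_distrib]
    refine Finset.sum_congr rfl fun m _ => ?_
    rw [hF m]
    simp only [LinearMap.add_apply, LinearMap.comp_apply, LinearMap.smul_apply]
    module
  have hK : Module.finrank ℤ_[p] ((m : Fin 3) → Fin (k m) → ℤ_[p]) = ∑ m, k m := by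
    rw [Module.finrank_pi_fintype]; simp
  let g₁ : V →ₗ[ℤ_[p]] ((m : Fin 3) → Fin (k m) → ℤ_[p]) := LinearMap.pi g
  let g₂ : (Fin l → ℤ_[p]) →ₗ[ℤ_[p]] ((m : Fin 3) → Fin (k m) → ℤ_[p]) :=
    LinearMap.pi fun m => u m • (g m ∘ₗ Q m)
  let h₁' : ((m : Fin 3) → Fin (k m) → ℤ_[p]) →ₗ[ℤ_[p]] V :=
    ∑ m, c m • (h m ∘ₗ LinearMap.proj m)
  let h₂' : ((m : Fin 3) → Fin (k m) → ℤ_[p]) →ₗ[ℤ_[p]] (Fin l → ℤ_[p]) :=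
    ρ ∘ₗ (∑ m, (c m * u m) • (h m ∘ₗ LinearMap.proj m))
  have e11 : ∀ v, h₁' (g₁ v) = ∑ m, c m • h m (g m v) := by
    intro v; simp [h₁', g₁]
  have e12 : ∀ a, h₁' (g₂ a) = ∑ m, (c m * u m) • h m (g m (Q m a)) := by
    intro a
    simp [h₁', g₂, mul_smul]
  have e21 : ∀ v, h₂' (g₁ v) = ρ (∑ m, (c m * u m) • h m (g m v)) := by
    intro v; simp [h₂', g₁]
  have e22 : ∀ a, h₂' (g₂ a) = ρ (∑ m, (c m * u m * u m) • h m (g m (Q m a))) := by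
    intro a
    simp [h₂', g₂, mul_smul]
  have hbij : Function.Bijective (h₂' ∘ₗ g₂) := by
    let D : (Fin l → ℤ_[p]) →ₗ[ℤ_[p]] (Fin l → ℤ_[p]) := h₂' ∘ₗ g₂ - LinearMap.id
    obtain ⟨N, hN⟩ := LinearMap.exists_eq_smul_of_forall D (p : ℤ_[p]) (by
      intro a
      obtain ⟨w, hw⟩ := h₄ a
      obtain ⟨w', hw'⟩ := hρ a
      refine ⟨w' + ρ (w - (p : ℤ_[p]) ^ i • ∑ m, (c m * u m * u m) • e m (Q m a)), ?_⟩
      change h₂' (g₂ a) - a = _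
      rw [e22, hs, hw, pow_succ', mul_smul, add_sub_assoc, ← smul_sub, map_add, hw', map_smul]
      module)
    refine bijective_of_eq_one_add_smul _ N fun a => ?_
    have : h₂' (g₂ a) - a = (p : ℤ_[p]) • N a := LinearMap.congr_fun hN a
    rw [LinearMap.comp_apply, ← this]
    abel
  obtain ⟨k', hk', G, I, T, hT⟩ := exists_complement h₂' g₂ hbij
  refine ⟨k', hk'.trans hK, FactorsMod.of_forall (G ∘ₗ g₁) (h₁' ∘ₗ I) fun v => ?_⟩
  obtain ⟨w₁, hw₁⟩ := h₁ v
  obtain ⟨w₂, hw₂⟩ := h₂ v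
  have hz : h₂' (g₁ v) = (p : ℤ_[p]) •
      ρ (w₂ - (p : ℤ_[p]) ^ i • ∑ m, (c m * u m) • e m v) := by
    rw [e21, hs, hw₂, pow_succ', mul_smul, ← smul_sub, map_smul]
  set a := T (ρ (w₂ - (p : ℤ_[p]) ^ i • ∑ m, (c m * u m) • e m v)) with ha
  obtain ⟨w₃, hw₃⟩ := h₃ a
  have hy : h₁' (g₂ a) = (p : ℤ_[p]) •
      (w₃ - (p : ℤ_[p]) ^ i • ∑ m, (c m * u m) • e m (Q m a)) := by
    rw [e12, hs, hw₃, pow_succ', mul_smul, ← smul_sub]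
  have h5 : h₁' (g₁ v) = h₁' (I (G (g₁ v))) + (p : ℤ_[p]) • h₁' (g₂ a) := by
    conv_lhs => rw [hT (g₁ v), hz]
    simp only [map_add, map_smul, ha]
  rw [e11, hs, hy] at h5
  obtain ⟨d, hd⟩ : (p : ℤ_[p]) ^ (i + 1) ∣ (p : ℤ_[p]) ^ 2 := pow_dvd_pow _ hj'
  refine ⟨w₁ + ∑ m, c m • e m v +
    d • (w₃ - (p : ℤ_[p]) ^ i • ∑ m, (c m * u m) • e m (Q m a)), ?_⟩
  rw [smul_smul, ← pow_two, hd, sub_eq_iff_eq_add] at h5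
  rw [hw₁, h5]
  simp only [LinearMap.comp_apply]
  module

end Key

section PencilModP

variable {p : ℕ} [Fact p.Prime]

theorem Matrix.exists_map_toZMod_eq {ι κ : Type*} (M : Matrix ι κ (ZMod p)) :
    ∃ N : Matrix ι κ ℤ_[p], N.map PadicInt.toZMod = M := by
  choose r hr using fun i k => toZMod_surjective (M i k)
  exact ⟨Matrix.of r, by ext i k; exact hr i k⟩

theorem Matrix.exists_eq_add_smul_of_map_eq {ι κ : Type*} {M N : Matrix ι κ ℤ_[p]}
    (h : M.map PadicInt.toZMod = N.map PadicInt.toZMod) :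
    ∃ E : Matrix ι κ ℤ_[p], M = N + (p : ℤ_[p]) • E := by
  have : ∀ i k, (p : ℤ_[p]) ∣ M i k - N i k := fun i k => by
    rw [← toZMod_eq_zero_iff, map_sub, sub_eq_zero]
    exact congrFun (congrFun h i) k
  choose r hr using this
  refine ⟨Matrix.of r, ?_⟩
  ext i k
  simp [← hr]

/-- Lagrange interpolation at `0` through three points: the weights reproduce polynomials of degree
at most two, and `x ^ 3` is interpolated to the product of the points. -/
theorem exists_lagrange_weights (u : Fin 3 → ℤ_[p])
    (hu : Function.Injective fun m => PadicInt.toZMod (u m)) :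
    ∃ c : Fin 3 → ℤ_[p], c 0 + c 1 + c 2 = 1 ∧ c 0 * u 0 + c 1 * u 1 + c 2 * u 2 = 0 ∧
      c 0 * u 0 ^ 2 + c 1 * u 1 ^ 2 + c 2 * u 2 ^ 2 = 0 ∧
      c 0 * u 0 ^ 3 + c 1 * u 1 ^ 3 + c 2 * u 2 ^ 3 = u 0 * u 1 * u 2 := by
  have hd : ∀ m n, m ≠ n → IsUnit (u m - u n) := fun m n h => by
    rw [isUnit_iff_toZMod_ne_zero, map_sub, sub_ne_zero]
    exact hu.ne h
  obtain ⟨D, hD⟩ := ((hd 0 1 (by decide)).mul (hd 0 2 (by decide))).mul (hd 1 2 (by decide))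
  have hD' : (u 0 - u 1) * (u 0 - u 2) * (u 1 - u 2) * (D⁻¹ : ℤ_[p]ˣ) = 1 := by
    rw [← hD, Units.mul_inv]
  refine ⟨![u 1 * u 2 * (u 1 - u 2) * (D⁻¹ : ℤ_[p]ˣ), -(u 0 * u 2 * (u 0 - u 2) * (D⁻¹ : ℤ_[p]ˣ)),
    u 0 * u 1 * (u 0 - u 1) * (D⁻¹ : ℤ_[p]ˣ)], ?_, ?_, ?_, ?_⟩ <;>
    simp only [Matrix.cons_val]
  · linear_combination hD'
  · ring
  · ring
  · linear_combination u 0 * u 1 * u 2 * hD'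

/-- The rank inequality behind the conditions for four points: if the values at three points of a
matrix polynomial `B + x C + p x ^ 2 E` factor modulo `p ^ j`, `j ≤ 2`, through ranks `k_m`, then
its value `B` at a fourth point factors through `∑ k_m - l` whenever some `B + x₀ C` has rank at
least `l` modulo `p`. -/
theorem FactorsMod.of_pencil {ι : Type*} [Fintype ι] [DecidableEq ι] {j l : ℕ} (hj : 1 ≤ j)
    (hj' : j ≤ 2) (B C E : Matrix ι ι ℤ_[p]) (u : Fin 3 → ℤ_[p])
    (hu : Function.Injective fun m => PadicInt.toZMod (u m))
    (hu0 : ∀ m, PadicInt.toZMod (u m) ≠ 0) {k : Fin 3 → ℕ}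
    (hF : ∀ m, FactorsMod ((p : ℤ_[p]) ^ j)
      (B + u m • C + ((p : ℤ_[p]) * u m ^ 2) • E).mulVecLin (k m))
    (x₀ : ℤ_[p]) (hl : l ≤ ((B + x₀ • C).map PadicInt.toZMod).rank) :
    ∃ k', k' + l = ∑ m, k m ∧ FactorsMod ((p : ℤ_[p]) ^ j) B.mulVecLin k' := by
  obtain ⟨c, hc0, hc1, hc2, hc3⟩ := exists_lagrange_weights u hu
  have hmap : ∀ x : ℤ_[p], ((B + x • C).map PadicInt.toZMod).mulVecLin =
      (B.map PadicInt.toZMod).mulVecLin +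
        (PadicInt.toZMod x) • (C.map PadicInt.toZMod).mulVecLin := by
    intro x
    have h1 : (B + x • C).map PadicInt.toZMod =
        B.map PadicInt.toZMod + PadicInt.toZMod x • C.map PadicInt.toZMod := by
      ext i k
      simp
    rw [h1]
    refine LinearMap.ext fun v => ?_
    simp
  obtain ⟨S, hS, hSy⟩ := exists_submodule_pencil (B.map PadicInt.toZMod).mulVecLin
    (C.map PadicInt.toZMod).mulVecLin (Set.range fun m => PadicInt.toZMod (u m))
    (PadicInt.toZMod x₀)
  rw [← hmap] at hS
  have hlS : l ≤ Module.finrank (ZMod p) S := hl.trans hS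
  let z : Fin l → (ι → ZMod p) := fun t => Module.finBasis (ZMod p) S (Fin.castLE hlS t)
  have hz : LinearIndependent (ZMod p) z :=
    ((Module.finBasis (ZMod p) S).linearIndependent.comp _ (Fin.castLE_injective hlS)).map'
      S.subtype S.ker_subtype
  choose y hy using fun t => hSy (z t) (Module.finBasis (ZMod p) S (Fin.castLE hlS t)).2
  choose q hq using fun m t => hy t _ ⟨m, rfl⟩
  -- a left inverse of the matrix with columns `z`
  obtain ⟨r, hr⟩ : ∃ r : Matrix (Fin l) ι (ZMod p), r * (Matrix.of z).transpose = 1 := by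
    obtain ⟨f, hf⟩ := LinearMap.exists_leftInverse_of_injective
      (Fintype.linearCombination (ZMod p) z) (LinearMap.ker_eq_bot.2
        (linearIndependent_iff_injective_fintypeLinearCombination.1 hz))
    refine ⟨LinearMap.toMatrix' f, ?_⟩
    ext a b
    have h1 : f (z b) = Pi.single b 1 := by
      have := LinearMap.congr_fun hf (Pi.single b 1)
      simpa [Fintype.linearCombination_apply_single] using this
    have h2 : (LinearMap.toMatrix' f).mulVec (z b) = f (z b) := by
      rw [← Matrix.toLin'_apply, Matrix.toLin'_toMatrix']
    have h3 := congrFun (h2.trans h1) a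
    rw [Matrix.mul_apply, Matrix.one_apply]
    rw [Matrix.mulVec, dotProduct] at h3
    simpa [Pi.single_apply, eq_comm] using h3
  obtain ⟨Zm, hZm⟩ := Matrix.exists_map_toZMod_eq (Matrix.of z).transpose
  obtain ⟨Ym, hYm⟩ := Matrix.exists_map_toZMod_eq (Matrix.of y).transpose
  choose Qm hQm using fun m => Matrix.exists_map_toZMod_eq (Matrix.of (q m)).transpose
  obtain ⟨d, hd⟩ : IsUnit (u 0 * u 1 * u 2) := by
    rw [isUnit_iff_toZMod_ne_zero]
    simp [hu0]
  obtain ⟨Rm, hRm⟩ := Matrix.exists_map_toZMod_eq r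
  have hQ : ∀ m, ∃ N : Matrix ι (Fin l) ℤ_[p],
      (B + u m • C + ((p : ℤ_[p]) * u m ^ 2) • E) * Qm m =
        Ym + u m • Zm + (p : ℤ_[p]) • N := by
    intro m
    refine Matrix.exists_eq_add_smul_of_map_eq ?_
    ext i t
    have h1 : ((B + u m • C).map PadicInt.toZMod).mulVec (q m t) =
        y t + PadicInt.toZMod (u m) • z t := by
      rw [← hq m t, ← hmap]
      rfl
    have h2 : (B + u m • C + ((p : ℤ_[p]) * u m ^ 2) • E).map PadicInt.toZMod =
        (B + u m • C).map PadicInt.toZMod := by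
      ext a b
      simp
    rw [Matrix.map_mul, h2, hQm]
    refine (congrFun h1 i).trans ?_
    have h3 : PadicInt.toZMod (Ym i t) = y t i := congrFun (congrFun hYm i) t
    have h4 : PadicInt.toZMod (Zm i t) = z t i := congrFun (congrFun hZm i) t
    simp [h3, h4]
  choose N hN using hQ
  obtain ⟨N', hN'⟩ : ∃ N' : Matrix (Fin l) (Fin l) ℤ_[p], Rm * Zm = 1 + (p : ℤ_[p]) • N' := by
    refine Matrix.exists_eq_add_smul_of_map_eq ?_
    rw [Matrix.map_mul, hRm, hZm, hr]
    simp
  have hQv : ∀ m a, (B + u m • C + ((p : ℤ_[p]) * u m ^ 2) • E).mulVec ((Qm m).mulVec a) =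
      Ym.mulVec a + u m • Zm.mulVec a + (p : ℤ_[p]) • (N m).mulVec a := by
    intro m a
    rw [Matrix.mulVec_mulVec, hN]
    simp [Matrix.add_mulVec, Matrix.smul_mulVec]
  refine FactorsMod.of_block hj hj' hF B.mulVecLin c u (fun m => (Qm m).mulVecLin)
    ((u 0 * u 1 * u 2) • Zm).mulVecLin (((d⁻¹ : ℤ_[p]ˣ) : ℤ_[p]) • Rm).mulVecLin ?_ ?_ ?_ ?_ ?_
  · intro v
    refine ⟨0, ?_⟩
    simp only [Fin.sum_univ_three, Matrix.mulVecLin_apply, Matrix.add_mulVec, Matrix.smul_mulVec]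
    linear_combination (norm := module) (-hc0) • B.mulVec v - hc1 • C.mulVec v -
      (p : ℤ_[p]) • hc2 • E.mulVec v
  · intro v
    refine ⟨(u 0 * u 1 * u 2) • E.mulVec v, ?_⟩
    simp only [Fin.sum_univ_three, Matrix.mulVecLin_apply, Matrix.add_mulVec, Matrix.smul_mulVec]
    linear_combination (norm := module) hc1 • B.mulVec v + hc2 • C.mulVec v +
      (p : ℤ_[p]) • hc3 • E.mulVec v
  · intro a
    refine ⟨∑ m, (c m * u m) • (N m).mulVec a, ?_⟩
    simp only [Fin.sum_univ_three, Matrix.mulVecLin_apply, hQv]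
    linear_combination (norm := module) hc1 • Ym.mulVec a + hc2 • Zm.mulVec a
  · intro a
    refine ⟨∑ m, (c m * u m * u m) • (N m).mulVec a, ?_⟩
    simp only [Fin.sum_univ_three, Matrix.mulVecLin_apply, hQv, Matrix.smul_mulVec]
    linear_combination (norm := module) hc2 • Ym.mulVec a + hc3 • Zm.mulVec a
  · intro a
    refine ⟨N'.mulVec a, ?_⟩
    have h1 : Rm.mulVec (Zm.mulVec a) = a + (p : ℤ_[p]) • N'.mulVec a := by
      rw [Matrix.mulVec_mulVec, hN']
      simp [Matrix.add_mulVec, Matrix.smul_mulVec]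
    simp only [Matrix.mulVecLin_apply, Matrix.smul_mulVec, Matrix.mulVec_smul, h1, ← hd, smul_smul,
      Units.mul_inv, one_smul]

/-- A matrix factors modulo `p` through its rank modulo `p`. -/
theorem FactorsMod.of_rank {ι : Type*} [Fintype ι] [DecidableEq ι] (B : Matrix ι ι ℤ_[p]) :
    FactorsMod ((p : ℤ_[p]) ^ 1) B.mulVecLin (B.map PadicInt.toZMod).rank := by
  let f := (B.map PadicInt.toZMod).mulVecLin
  let b := Module.finBasis (ZMod p) (LinearMap.range f)
  obtain ⟨P, hP⟩ := Matrix.exists_map_toZMod_eq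
    (LinearMap.toMatrix' ((LinearMap.range f).subtype ∘ₗ b.equivFun.symm.toLinearMap))
  obtain ⟨Q, hQ⟩ := Matrix.exists_map_toZMod_eq
    (LinearMap.toMatrix' (b.equivFun.toLinearMap ∘ₗ f.rangeRestrict))
  obtain ⟨N, hN⟩ := Matrix.exists_eq_add_smul_of_map_eq (M := B) (N := P * Q) (by
    rw [Matrix.map_mul, hP, hQ, ← LinearMap.toMatrix'_comp, LinearMap.comp_assoc,
      ← LinearMap.comp_assoc _ _ b.equivFun.symm.toLinearMap]
    simp only [LinearEquiv.symm_comp, LinearMap.id_comp, LinearMap.subtype_comp_codRestrict]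
    exact (LinearMap.toMatrix'_toLin' _).symm)
  refine ⟨Q.mulVecLin, P.mulVecLin, N.mulVecLin, LinearMap.ext fun v => ?_⟩
  have := congrArg (fun M => M.mulVec v) hN
  change B.mulVec v = P.mulVec (Q.mulVec v) + (p : ℤ_[p]) ^ 1 • N.mulVec v
  rw [Matrix.mulVec_mulVec, pow_one]
  simpa [Matrix.add_mulVec, Matrix.smul_mulVec] using this

end PencilModP

/-! ### Reduction of `A + p x` to a quadratic matrix polynomial divisible by `p` -/

section Schur

/-- Isomorphic maps have isomorphic cokernels. -/
theorem nonempty_quotient_range_equiv {R V W V' W' : Type*} [CommRing R] [AddCommGroup V]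
    [Module R V] [AddCommGroup W] [Module R W] [AddCommGroup V'] [Module R V'] [AddCommGroup W']
    [Module R W'] (f : V →ₗ[R] W) (f' : V' →ₗ[R] W') (a : V ≃ₗ[R] V') (b : W ≃ₗ[R] W')
    (h : ∀ v, b (f v) = f' (a v)) :
    Nonempty ((W ⧸ LinearMap.range f) ≃ₗ[R] (W' ⧸ LinearMap.range f')) := by
  refine ⟨Submodule.Quotient.equiv _ _ b ?_⟩
  ext w
  constructor
  · rintro ⟨_, ⟨v, rfl⟩, rfl⟩
    exact ⟨a v, (h v).symm⟩
  · rintro ⟨v, rfl⟩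
    exact ⟨f (a.symm v), ⟨_, rfl⟩, by simp [h]⟩

/-- A surjection onto a cokernel identifies the cokernel of any map whose range is its kernel. -/
theorem nonempty_quotient_range_equiv_of_surjective {R V W H : Type*} [CommRing R]
    [AddCommGroup V] [Module R V] [AddCommGroup W] [Module R W] [AddCommGroup H] [Module R H]
    (f : V →ₗ[R] W) (φ : W →ₗ[R] H) (hφ : Function.Surjective φ)
    (h : ∀ w, φ w = 0 ↔ ∃ v, f v = w) :
    Nonempty ((W ⧸ LinearMap.range f) ≃ₗ[R] H) := by
  refine ⟨(Submodule.quotEquivOfEq _ _ ?_).trans (φ.quotKerEquivOfSurjective hφ)⟩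
  ext w
  exact (h w).symm

/-- An invertible diagonal block can be removed from a matrix without changing the cokernel, at the
price of replacing the other diagonal block by its Schur complement. -/
theorem nonempty_quotient_fromBlocks_equiv {R ι κ : Type*} [CommRing R] [Fintype ι] [Fintype κ]
    [DecidableEq ι] (P : Matrix ι ι R) (Q : Matrix ι κ R) (S : Matrix κ ι R) (T : Matrix κ κ R)
    (hP : IsUnit P.det) :
    Nonempty (((ι ⊕ κ → R) ⧸ LinearMap.range (Matrix.fromBlocks P Q S T).mulVecLin) ≃ₗ[R]
      ((κ → R) ⧸ LinearMap.range (T - S * P⁻¹ * Q).mulVecLin)) := by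
  let a : (ι ⊕ κ → R) →ₗ[R] (ι → R) := LinearMap.funLeft R R Sum.inl
  let b : (ι ⊕ κ → R) →ₗ[R] (κ → R) := LinearMap.funLeft R R Sum.inr
  let ψ : (ι ⊕ κ → R) →ₗ[R] (κ → R) := b - (S * P⁻¹).mulVecLin ∘ₗ a
  have hab : ∀ w, w = Sum.elim (a w) (b w) := fun w => (Sum.elim_comp_inl_inr w).symm
  refine nonempty_quotient_range_equiv_of_surjective _ (Submodule.mkQ _ ∘ₗ ψ)
    ((Submodule.mkQ_surjective _).comp fun v => ⟨Sum.elim 0 v, ?_⟩) fun w => ?_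
  · have h1 : a (Sum.elim 0 v) = 0 := rfl
    have h2 : b (Sum.elim 0 v) = v := rfl
    simp [ψ, h1, h2]
  · rw [LinearMap.comp_apply, Submodule.mkQ_apply, Submodule.Quotient.mk_eq_zero]
    have hψ : ψ w = b w - (S * P⁻¹).mulVec (a w) := rfl
    rw [hψ]
    constructor
    · rintro ⟨v, hv⟩
      rw [Matrix.mulVecLin_apply] at hv
      refine ⟨Sum.elim (P⁻¹.mulVec (a w) - P⁻¹.mulVec (Q.mulVec v)) v, ?_⟩
      rw [Matrix.mulVecLin_apply, Matrix.fromBlocks_mulVec, hab w]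
      congr 1
      · simp only [Sum.elim_comp_inl, Sum.elim_comp_inr, Matrix.mulVec_sub, Matrix.mulVec_mulVec,
          ← Matrix.mul_assoc, Matrix.mul_nonsing_inv P hP, Matrix.one_mul, Matrix.one_mulVec]
        rw [sub_add_cancel]
        rfl
      · simp only [Sum.elim_comp_inl, Sum.elim_comp_inr, Matrix.mulVec_sub, Matrix.mulVec_mulVec,
          ← Matrix.mul_assoc]
        rw [Matrix.sub_mulVec] at hv
        rw [← hab w]
        linear_combination (norm := module) hv
    · rintro ⟨v, rfl⟩
      refine ⟨v ∘ Sum.inr, ?_⟩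
      have h1 : a ((Matrix.fromBlocks P Q S T).mulVecLin v) =
          P.mulVec (v ∘ Sum.inl) + Q.mulVec (v ∘ Sum.inr) := by
        rw [Matrix.mulVecLin_apply, Matrix.fromBlocks_mulVec]
        rfl
      have h2 : b ((Matrix.fromBlocks P Q S T).mulVecLin v) =
          S.mulVec (v ∘ Sum.inl) + T.mulVec (v ∘ Sum.inr) := by
        rw [Matrix.mulVecLin_apply, Matrix.fromBlocks_mulVec]
        rfl
      have h3 : S * P⁻¹ * P = S := by
        rw [Matrix.mul_assoc, Matrix.nonsing_inv_mul P hP, Matrix.mul_one]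
      rw [h1, h2, Matrix.mulVecLin_apply, Matrix.mulVec_add, Matrix.mulVec_mulVec,
        Matrix.mulVec_mulVec, h3, Matrix.sub_mulVec]
      abel

variable {p : ℕ} [Fact p.Prime]

theorem isUnit_det_of_map {ι : Type*} [Fintype ι] [DecidableEq ι] {M : Matrix ι ι ℤ_[p]}
    (h : (M.map PadicInt.toZMod).det ≠ 0) : IsUnit M.det := by
  rw [isUnit_iff_toZMod_ne_zero, RingHom.map_det]
  exact h

/-- Diagonalising `A` modulo `p` and removing the invertible block turns the family `A + p x` into
`p (B + x C + p x ^ 2 E)` modulo `p ^ 3`. -/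
theorem exists_quadratic_reduction {n : ℕ} (A : Matrix (Fin n) (Fin n) ℤ_[p]) :
    ∃ (ι : Type) (_ : Fintype ι) (_ : DecidableEq ι) (B C E : Matrix ι ι ℤ_[p]),
      ∀ x : ℤ_[p], ∃ E' : Matrix ι ι ℤ_[p], Nonempty
        (cok (A + ((p : ℤ_[p]) * x) • (1 : Matrix (Fin n) (Fin n) ℤ_[p])) ≃ₗ[ℤ_[p]]
          ((ι → ℤ_[p]) ⧸ LinearMap.range ((p : ℤ_[p]) •
            (B + x • C + ((p : ℤ_[p]) * x ^ 2) • E + (p : ℤ_[p]) ^ 2 • E').mulVecLin))) := by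
  obtain ⟨L, L', D, hD⟩ := Matrix.Pivot.exists_list_transvec_mul_mul_list_transvec_eq_diagonal
    (A.map PadicInt.toZMod)
  obtain ⟨U, hU⟩ := Matrix.exists_map_toZMod_eq
    (L.map Matrix.TransvectionStruct.toMatrix).prod
  obtain ⟨V, hV⟩ := Matrix.exists_map_toZMod_eq
    (L'.map Matrix.TransvectionStruct.toMatrix).prod
  have hUd : IsUnit U.det := isUnit_det_of_map (by
    rw [hU, Matrix.TransvectionStruct.det_toMatrix_prod]; exact one_ne_zero)
  have hVd : IsUnit V.det := isUnit_det_of_map (by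
    rw [hV, Matrix.TransvectionStruct.det_toMatrix_prod]; exact one_ne_zero)
  let e := Equiv.sumCompl fun i => D i ≠ 0
  have hdiag : (U * A * V).map PadicInt.toZMod = Matrix.diagonal D := by
    rw [Matrix.map_mul, Matrix.map_mul, hU, hV, hD]
  have hent : ∀ i k, PadicInt.toZMod ((U * A * V) i k) = Matrix.diagonal D i k := fun i k =>
    congrFun (congrFun hdiag i) k
  let X := (U * A * V).submatrix e e
  let Y := (U * V).submatrix e e
  have hQ : ∃ Q, X.toBlocks₁₂ = 0 + (p : ℤ_[p]) • Q := by
    refine Matrix.exists_eq_add_smul_of_map_eq ?_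
    ext i k
    refine (hent _ _).trans ?_
    have : (e (Sum.inl i)) ≠ e (Sum.inr k) := fun h => by simpa using e.injective h
    simp [this]
  have hS : ∃ S, X.toBlocks₂₁ = 0 + (p : ℤ_[p]) • S := by
    refine Matrix.exists_eq_add_smul_of_map_eq ?_
    ext i k
    refine (hent _ _).trans ?_
    have : (e (Sum.inr i)) ≠ e (Sum.inl k) := fun h => by simpa using e.injective h
    simp [this]
  have hT : ∃ T, X.toBlocks₂₂ = 0 + (p : ℤ_[p]) • T := by
    refine Matrix.exists_eq_add_smul_of_map_eq ?_
    ext i k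
    refine (hent _ _).trans ?_
    have hi : D (e (Sum.inr i)) = 0 := not_not.1 i.2
    by_cases h : e (Sum.inr i) = e (Sum.inr k)
    · rw [← h, Matrix.diagonal_apply_eq, hi]
      simp
    · simp [h]
  obtain ⟨Q, hQ⟩ := hQ
  obtain ⟨S, hS⟩ := hS
  obtain ⟨T, hT⟩ := hT
  rw [zero_add] at hQ hS hT
  set P := X.toBlocks₁₁ with hPdef
  set P' := Y.toBlocks₁₁ with hPdef'
  set Q' := Y.toBlocks₁₂ with hQdef'
  set S' := Y.toBlocks₂₁ with hSdef'
  set T' := Y.toBlocks₂₂ with hTdef'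
  have hPx : ∀ x : ℤ_[p], IsUnit (P + ((p : ℤ_[p]) * x) • P').det := by
    intro x
    refine isUnit_det_of_map ?_
    have : (P + ((p : ℤ_[p]) * x) • P').map PadicInt.toZMod =
        Matrix.diagonal fun i : {i // D i ≠ 0} => D i := by
      ext i k
      have h1 : PadicInt.toZMod (P i k) = Matrix.diagonal D i k := hent _ _
      simp [h1, Matrix.diagonal_apply, Subtype.ext_iff]
    rw [this, Matrix.det_diagonal]
    exact Finset.prod_ne_zero_iff.2 fun i _ => i.2
  have hP0 : IsUnit P.det := by simpa using hPx 0
  refine ⟨_, inferInstance, inferInstance, T - (p : ℤ_[p]) • (S * P⁻¹ * Q),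
    T' - (p : ℤ_[p]) • (S * P⁻¹ * Q' + S' * P⁻¹ * Q), -(S' * P⁻¹ * Q'), fun x => ?_⟩
  let Z := (P + ((p : ℤ_[p]) * x) • P')⁻¹
  -- the resolvent identity for the invertible block
  have hZ : Z = P⁻¹ - ((p : ℤ_[p]) * x) • (P⁻¹ * P' * Z) := by
    have h1 : P⁻¹ * ((P + ((p : ℤ_[p]) * x) • P') * Z) = P⁻¹ := by
      rw [Matrix.mul_nonsing_inv _ (hPx x), Matrix.mul_one]
    rw [Matrix.add_mul, Matrix.mul_add, ← Matrix.mul_assoc, Matrix.nonsing_inv_mul _ hP0,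
      Matrix.one_mul, Matrix.smul_mul, Matrix.mul_smul, ← Matrix.mul_assoc] at h1
    exact eq_sub_of_add_eq h1
  refine ⟨(S + x • S') * (x • (P⁻¹ * P' * Z)) * (Q + x • Q'), ?_⟩
  let M := U * (A + ((p : ℤ_[p]) * x) • (1 : Matrix (Fin n) (Fin n) ℤ_[p])) * V
  have hM : M.submatrix e e = Matrix.fromBlocks (P + ((p : ℤ_[p]) * x) • P')
      ((p : ℤ_[p]) • (Q + x • Q')) ((p : ℤ_[p]) • (S + x • S')) ((p : ℤ_[p]) • (T + x • T')) := by
    have h1 : M.submatrix e e = X + ((p : ℤ_[p]) * x) • Y := by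
      simp only [M, X, Y, Matrix.mul_add, Matrix.add_mul, Matrix.mul_smul, Matrix.smul_mul,
        Matrix.mul_one]
      rfl
    rw [h1, ← Matrix.fromBlocks_toBlocks X, ← Matrix.fromBlocks_toBlocks Y,
      Matrix.fromBlocks_smul, Matrix.fromBlocks_add, hQ, hS, hT]
    simp only [smul_add, smul_smul, hPdef, hPdef', hQdef', hSdef', hTdef']
  have e1 : Nonempty (cok (A + ((p : ℤ_[p]) * x) • (1 : Matrix (Fin n) (Fin n) ℤ_[p]))
      ≃ₗ[ℤ_[p]] (_ ⧸ LinearMap.range (M.submatrix e e).mulVecLin)) := by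
    refine nonempty_quotient_range_equiv _ _
      ((Matrix.toLin'OfInv (M := V) (M' := V⁻¹) (Matrix.mul_nonsing_inv V hVd)
        (Matrix.nonsing_inv_mul V hVd)).trans (LinearEquiv.funCongrLeft ℤ_[p] ℤ_[p] e))
      ((Matrix.toLin'OfInv (M := U⁻¹) (M' := U) (Matrix.nonsing_inv_mul U hUd)
        (Matrix.mul_nonsing_inv U hUd)).trans (LinearEquiv.funCongrLeft ℤ_[p] ℤ_[p] e))
      fun v => ?_
    change (U.mulVec (Matrix.mulVec _ v)) ∘ e =
      (M.submatrix e e).mulVec ((V⁻¹.mulVec v) ∘ e)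
    rw [Matrix.submatrix_mulVec_equiv, Function.comp_assoc, Equiv.self_comp_symm,
      Function.comp_id, Matrix.mulVec_mulVec, Matrix.mulVec_mulVec, Matrix.mul_assoc _ V,
      Matrix.mul_nonsing_inv V hVd, Matrix.mul_one]
  obtain ⟨e1⟩ := e1
  obtain ⟨e2⟩ := nonempty_quotient_fromBlocks_equiv _ ((p : ℤ_[p]) • (Q + x • Q'))
    ((p : ℤ_[p]) • (S + x • S')) ((p : ℤ_[p]) • (T + x • T')) (hPx x)
  refine ⟨e1.trans ((Submodule.quotEquivOfEq _ _ (by rw [hM])).trans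
    (e2.trans (Submodule.quotEquivOfEq _ _ ?_)))⟩
  congr 1
  refine LinearMap.ext fun v => ?_
  rw [LinearMap.smul_apply, Matrix.mulVecLin_apply, Matrix.mulVecLin_apply, ← Matrix.smul_mulVec]
  congr 1
  rw [show (P + ((p : ℤ_[p]) * x) • P')⁻¹ = Z from rfl]
  generalize hK : x • (P⁻¹ * P' * Z) = K
  rw [mul_smul, hK] at hZ
  rw [hZ]
  simp only [Matrix.add_mul, Matrix.mul_add, Matrix.sub_mul, Matrix.mul_sub, Matrix.smul_mul,
    Matrix.mul_smul, smul_add, smul_sub, smul_smul, smul_neg]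
  module

end Schur

/-! ### Necessity of the conditions -/

theorem Multiset.countP_le_eq_count_add (t : Multiset ℕ∞) (j : ℕ) :
    (t.countP fun e => (j : ℕ∞) ≤ e) =
      t.count (j : ℕ∞) + t.countP fun e => ((j + 1 : ℕ) : ℕ∞) ≤ e := by
  classical
  induction t using Multiset.induction with
  | empty => simp
  | cons a t ih =>
    rw [Multiset.countP_cons, Multiset.countP_cons, Multiset.count_cons, ih]
    have h : ((j + 1 : ℕ) : ℕ∞) ≤ a ↔ (j : ℕ∞) < a := by
      rw [Nat.cast_add, Nat.cast_one]
      exact ENat.add_one_le_iff (ENat.natCast_ne_top j)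
    by_cases h1 : (j : ℕ∞) = a
    · subst h1
      have h3 : ¬ ((j + 1 : ℕ) : ℕ∞) ≤ j := fun h4 => lt_irrefl _ (h.1 h4)
      rw [if_pos le_rfl, if_neg h3, if_pos rfl]
      ring
    · have h2 : (j : ℕ∞) ≤ a ↔ (j : ℕ∞) < a := ⟨fun h => lt_of_le_of_ne h h1, le_of_lt⟩
      simp only [h, h2, h1, if_false, add_zero, add_assoc]

section Necessity

variable {p : ℕ} [Fact p.Prime]

theorem FactorsMod.smul {V W : Type*} [AddCommGroup V] [Module ℤ_[p] V] [AddCommGroup W]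
    [Module ℤ_[p] W] {q : ℤ_[p]} {k : ℕ} {f : V →ₗ[ℤ_[p]] W} (hf : FactorsMod q f k)
    (c : ℤ_[p]) : FactorsMod q (c • f) k :=
  hf.comp (c • LinearMap.id) LinearMap.id

/-- The numbers of parts of the members of a tuple in `𝒞` are governed by the ranks modulo powers
of `p` of the values at the `x_i` of one quadratic matrix polynomial. -/
theorem MemC.exists_pencil {m : ℕ} {x : Fin m → ℤ_[p]} {H : Fin m → Type*}
    [∀ i, AddCommGroup (H i)] [∀ i, Module ℤ_[p] (H i)] {t : Fin m → Multiset ℕ∞}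
    (h : MemC x H) (ht : ∀ i, IsoParts p (H i) (t i)) :
    ∃ (ι : Type) (_ : Fintype ι) (_ : DecidableEq ι) (B C E : Matrix ι ι ℤ_[p]),
      (∀ i, ∀ j ≤ 2, ∃ k, k + (t i).countP (fun e => ((j + 1 : ℕ) : ℕ∞) ≤ e) = Fintype.card ι ∧
        FactorsMod ((p : ℤ_[p]) ^ j) (B + x i • C + ((p : ℤ_[p]) * x i ^ 2) • E).mulVecLin k) ∧
      ∀ i, ∀ j ≤ 2, ∀ k,
        FactorsMod ((p : ℤ_[p]) ^ j) (B + x i • C + ((p : ℤ_[p]) * x i ^ 2) • E).mulVecLin k →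
          Fintype.card ι ≤ k + (t i).countP (fun e => ((j + 1 : ℕ) : ℕ∞) ≤ e) := by
  obtain ⟨n, A, hA⟩ := h
  obtain ⟨ι, _, _, B, C, E, hE⟩ := exists_quadratic_reduction A
  refine ⟨ι, inferInstance, inferInstance, B, C, E, ?_⟩
  choose E' hE' using fun i => hE (x i)
  have hiso : ∀ i, IsoParts p ((ι → ℤ_[p]) ⧸ LinearMap.range ((p : ℤ_[p]) •
      (B + x i • C + ((p : ℤ_[p]) * x i ^ 2) • E + (p : ℤ_[p]) ^ 2 • E' i).mulVecLin)) (t i) := by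
    intro i
    obtain ⟨e⟩ := hE' i
    obtain ⟨e'⟩ := hA i
    exact (ht i).congr (e.symm.trans e')
  have hV : Module.finrank ℤ_[p] (ι → ℤ_[p]) = Fintype.card ι :=
    Module.finrank_fintype_fun_eq_card _
  have hpow : ∀ j ≤ 2, ∃ d : ℤ_[p], (p : ℤ_[p]) ^ 2 = (p : ℤ_[p]) ^ j * d := fun j hj =>
    pow_dvd_pow _ hj
  constructor
  · intro i j hj
    obtain ⟨φ, hφ⟩ := (hiso i).exists_surjective (j + 1)
    obtain ⟨k, hk, hF⟩ := factorsMod_of_surjective _ φ hφ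
    obtain ⟨d, hd⟩ := hpow j hj
    refine ⟨k, hk.trans hV, hF.congr (-(d • (E' i).mulVecLin)) fun v => ?_⟩
    simp only [hd, Matrix.mulVecLin_apply, Matrix.add_mulVec, Matrix.smul_mulVec,
      LinearMap.neg_apply, LinearMap.smul_apply]
    module
  · intro i j hj k hF
    obtain ⟨d, hd⟩ := hpow j hj
    rw [← hV]
    refine FactorsMod.finrank_le (hF.congr (d • (E' i).mulVecLin) fun v => ?_) (hiso i)
    simp only [hd, Matrix.mulVecLin_apply, Matrix.add_mulVec, Matrix.smul_mulVec,
      LinearMap.smul_apply]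
    module

variable {m : ℕ} {x : Fin m → ℤ_[p]} {H : Fin m → Type*}
    [∀ i, AddCommGroup (H i)] [∀ i, Module ℤ_[p] (H i)] {t : Fin m → Multiset ℕ∞}

theorem DistinctModP.isUnit_sub (hx : DistinctModP x) {i j : Fin m} (h : i ≠ j) :
    IsUnit (x i - x j) := by
  rw [isUnit_iff_toZMod_ne_zero, map_sub, sub_ne_zero]
  exact hx.ne h

theorem Multiset.countP_one_le_eq_card {t : Multiset ℕ∞} (h : 0 ∉ t) :
    (t.countP fun e => ((0 + 1 : ℕ) : ℕ∞) ≤ e) = t.card := by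
  rw [Multiset.countP_eq_card]
  intro a ha
  simpa using Order.one_le_iff_pos.2 (pos_iff_ne_zero.2 fun h' : a = 0 => h (h' ▸ ha))

theorem Multiset.count_one_add_countP {t : Multiset ℕ∞} (h : 0 ∉ t) :
    t.count 1 + t.countP (fun e => ((2 : ℕ) : ℕ∞) ≤ e) = t.card := by
  have h1 := Multiset.countP_le_eq_count_add t 1
  rw [show ((1 : ℕ) : ℕ∞) = 1 from rfl] at h1
  rw [← Multiset.countP_one_le_eq_card h]
  exact h1.symm

theorem MemC.card_eq (h : MemC x H) (ht : ∀ i, IsoParts p (H i) (t i)) (h0 : ∀ i, 0 ∉ t i)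
    (i j : Fin m) : (t i).card = (t j).card := by
  obtain ⟨ι, _, _, B, C, E, hup, hdown⟩ := h.exists_pencil ht
  have key : ∀ i, (t i).card = Fintype.card ι := by
    intro i
    obtain ⟨k, hk, -⟩ := hup i 0 (by norm_num)
    have h1 := hdown i 0 (by norm_num) 0
      ⟨0, 0, (B + x i • C + ((p : ℤ_[p]) * x i ^ 2) • E).mulVecLin, by simp⟩
    rw [Multiset.countP_one_le_eq_card (h0 i)] at hk h1
    omega
  rw [key, key]

/-- Modulo `p` the values at three points are linearly dependent, so their ranks satisfy the
triangle inequality. -/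
theorem MemC.triangle (hx : DistinctModP x) (h : MemC x H) (ht : ∀ i, IsoParts p (H i) (t i))
    (h0 : ∀ i, 0 ∉ t i) {i j k : Fin m} (hjk : j ≠ k) :
    (t i).count 1 ≤ (t j).count 1 + (t k).count 1 := by
  have hcard := h.card_eq ht h0
  obtain ⟨ι, _, _, B, C, E, hup, hdown⟩ := h.exists_pencil ht
  obtain ⟨a, ha, hFa⟩ := hup j 1 (by norm_num)
  obtain ⟨b, hb, hFb⟩ := hup k 1 (by norm_num)
  obtain ⟨c, hc, -⟩ := hup i 0 (by norm_num)
  obtain ⟨D, hD⟩ := hx.isUnit_sub hjk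
  have hD' : (x j - x k) * (D⁻¹ : ℤ_[p]ˣ) = 1 := by rw [← hD, Units.mul_inv]
  have hF := (hFa.smul ((x i - x k) * (D⁻¹ : ℤ_[p]ˣ))).add
    (hFb.smul ((x j - x i) * (D⁻¹ : ℤ_[p]ˣ)))
  have h1 := hdown i 1 (by norm_num) _ (hF.congr (((x i ^ 2 - (x i - x k) * (D⁻¹ : ℤ_[p]ˣ) * x j ^ 2
    - (x j - x i) * (D⁻¹ : ℤ_[p]ˣ) * x k ^ 2) • E.mulVecLin)) fun v => by
      simp only [Matrix.mulVecLin_apply, Matrix.add_mulVec, Matrix.smul_mulVec,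
        LinearMap.smul_apply, LinearMap.add_apply, pow_one]
      linear_combination (norm := module) (-hD') • B.mulVec v - (x i * hD') • C.mulVec v)
  have e1 := fun i => Multiset.countP_le_eq_count_add (t i) 1
  have e0 := fun i => Multiset.countP_one_le_eq_card (h0 i)
  have d1 := hcard i j
  have d2 := hcard i k
  have := hdown i 0 (by norm_num) 0
      ⟨0, 0, (B + x i • C + ((p : ℤ_[p]) * x i ^ 2) • E).mulVecLin, by simp⟩
  have e1i := e1 i
  have e1j := e1 j
  have e1k := e1 k
  have e0i := e0 i
  have e0j := e0 j
  have e0k := e0 k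
  simp only [zero_add, Nat.cast_one] at *
  omega

/-- The inequality for four points at level `j`, in terms of the numbers of parts exceeding `j`. -/
theorem MemC.four_points {x : Fin 4 → ℤ_[p]} {H : Fin 4 → Type*}
    [∀ i, AddCommGroup (H i)] [∀ i, Module ℤ_[p] (H i)] {t : Fin 4 → Multiset ℕ∞}
    (hx : DistinctModP x) (h : MemC x H) (ht : ∀ i, IsoParts p (H i) (t i))
    (h0 : ∀ i, 0 ∉ t i) (i a : Fin 4) {j : ℕ} (hj : 1 ≤ j) (hj' : j ≤ 2) :
    (∑ s : Fin 3, (t (a.succAbove s)).countP fun e => ((j + 1 : ℕ) : ℕ∞) ≤ e) ≤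
      (t i).card + ((t i).countP fun e => ((2 : ℕ) : ℕ∞) ≤ e) +
        (t a).countP fun e => ((j + 1 : ℕ) : ℕ∞) ≤ e := by
  obtain ⟨ι, _, _, B, C, E, hup, hdown⟩ := h.exists_pencil ht
  have hcard : (t i).card = Fintype.card ι := by
    obtain ⟨k, hk, -⟩ := hup i 0 (by norm_num)
    have h1 := hdown i 0 (by norm_num) 0
      ⟨0, 0, (B + x i • C + ((p : ℤ_[p]) * x i ^ 2) • E).mulVecLin, by simp⟩
    rw [Multiset.countP_one_le_eq_card (h0 i)] at hk h1
    omega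
  choose k hk hF using fun s : Fin 3 => hup (a.succAbove s) j hj'
  -- the polynomial expanded at `x a`
  have hshift : ∀ y : ℤ_[p], B + y • C + ((p : ℤ_[p]) * y ^ 2) • E =
      (B + x a • C + ((p : ℤ_[p]) * x a ^ 2) • E) +
        (y - x a) • (C + ((p : ℤ_[p]) * (2 * x a)) • E) +
          ((p : ℤ_[p]) * (y - x a) ^ 2) • E := by
    intro y
    module
  obtain ⟨k', hk', hF'⟩ := FactorsMod.of_pencil hj hj' _ (C + ((p : ℤ_[p]) * (2 * x a)) • E) E
    (fun s => x (a.succAbove s) - x a) (fun s s' hs => by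
      simp only [map_sub, sub_left_inj] at hs
      exact Fin.succAbove_right_injective (hx hs))
    (fun s => by
      rw [← isUnit_iff_toZMod_ne_zero]
      exact hx.isUnit_sub (Fin.succAbove_ne a s))
    (fun s => by rw [← hshift]; exact hF s) (x i - x a) le_rfl
  have h1 := hdown a j hj' k' hF'
  have h2 := hdown i 1 (by norm_num) _ ((FactorsMod.of_rank
    (B + x a • C + ((p : ℤ_[p]) * x a ^ 2) • E +
      (x i - x a) • (C + ((p : ℤ_[p]) * (2 * x a)) • E))).congr
        ((x i - x a) ^ 2 • E.mulVecLin) fun v => by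
      simp only [hshift (x i), Matrix.mulVecLin_apply, Matrix.add_mulVec, Matrix.smul_mulVec,
        LinearMap.smul_apply, pow_one]
      module)
  have h3 : ∑ s, k s + (∑ s : Fin 3, (t (a.succAbove s)).countP fun e => ((j + 1 : ℕ) : ℕ∞) ≤ e) =
      3 * Fintype.card ι := by
    rw [← Finset.sum_add_distrib, Finset.sum_congr rfl fun s _ => hk s]
    simp
  simp only [one_add_one_eq_two] at h2
  omega

theorem MemC.four_points_one {x : Fin 4 → ℤ_[p]} {H : Fin 4 → Type*}
    [∀ i, AddCommGroup (H i)] [∀ i, Module ℤ_[p] (H i)] {t : Fin 4 → Multiset ℕ∞}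
    (hx : DistinctModP x) (h : MemC x H) (ht : ∀ i, IsoParts p (H i) (t i))
    (h0 : ∀ i, 0 ∉ t i) (i : Fin 4) : 3 * (t i).count 1 ≤ ∑ k, (t k).count 1 := by
  have h1 := h.four_points hx ht h0 i i (j := 1) le_rfl (by norm_num)
  have e1 : ∀ k, (t k).count 1 + (t k).countP (fun e => ((2 : ℕ) : ℕ∞) ≤ e) = (t i).card := by
    intro k
    rw [h.card_eq ht h0 i k, Multiset.count_one_add_countP (h0 k)]
  have h2 : ∑ s : Fin 3, (t (i.succAbove s)).count 1 +
      (∑ s : Fin 3, (t (i.succAbove s)).countP fun e => ((2 : ℕ) : ℕ∞) ≤ e) =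
        3 * (t i).card := by
    rw [← Finset.sum_add_distrib, Finset.sum_congr rfl fun s _ => e1 _]
    simp
  rw [Fin.sum_univ_succAbove _ i]
  have := e1 i
  simp only [one_add_one_eq_two] at h1
  omega

theorem MemC.four_points_two {x : Fin 4 → ℤ_[p]} {H : Fin 4 → Type*}
    [∀ i, AddCommGroup (H i)] [∀ i, Module ℤ_[p] (H i)] {t : Fin 4 → Multiset ℕ∞}
    (hx : DistinctModP x) (h : MemC x H) (ht : ∀ i, IsoParts p (H i) (t i))
    (h0 : ∀ i, 0 ∉ t i) (i a : Fin 4) :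
    (t i).count 1 + 2 * ((t a).count 1 + (t a).count 2) ≤
      ∑ k, (t k).count 1 + ∑ k, (t k).count 2 := by
  have h1 := h.four_points hx ht h0 i a (j := 2) (by norm_num) le_rfl
  have e1 : ∀ k, (t k).count 1 + (t k).countP (fun e => ((2 : ℕ) : ℕ∞) ≤ e) = (t i).card := by
    intro k
    rw [h.card_eq ht h0 i k, Multiset.count_one_add_countP (h0 k)]
  have e2 : ∀ k, (t k).count 1 + (t k).count 2 +
      (t k).countP (fun e => ((2 + 1 : ℕ) : ℕ∞) ≤ e) = (t i).card := by
    intro k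
    rw [← e1 k, Multiset.countP_le_eq_count_add _ 2, add_assoc]
    rfl
  have h2 : ∑ s : Fin 3, ((t (a.succAbove s)).count 1 + (t (a.succAbove s)).count 2) +
      (∑ s : Fin 3, (t (a.succAbove s)).countP fun e => ((2 + 1 : ℕ) : ℕ∞) ≤ e) =
        3 * (t i).card := by
    rw [← Finset.sum_add_distrib, Finset.sum_congr rfl fun s _ => e2 _]
    simp
  rw [← Finset.sum_add_distrib, Fin.sum_univ_succAbove _ a]
  have := e1 i
  have := e2 a
  omega

end Necessity

/-! ### Realising tuples of cokernels -/

/-- The modules described by the partitions `t i` are the cokernels of `A + p x_i` for one matrix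
`A`. -/
def Realizable {p : ℕ} [Fact p.Prime] {m : ℕ} (x : Fin m → ℤ_[p]) (t : Fin m → Multiset ℕ∞) :
    Prop :=
  ∃ (n : ℕ) (A : Matrix (Fin n) (Fin n) ℤ_[p]),
    ∀ i, IsoParts p (cok (A + ((p : ℤ_[p]) * x i) • (1 : Matrix (Fin n) (Fin n) ℤ_[p]))) (t i)

/-- The `ℤ_p`-algebra of functions on the index set that are polynomials in the point `p x_i`. -/
noncomputable def polyValues {p : ℕ} [Fact p.Prime] {m : ℕ} (x : Fin m → ℤ_[p]) :
    Subalgebra ℤ_[p] (Fin m → ℤ_[p]) :=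
  Algebra.adjoin ℤ_[p] {fun i => (p : ℤ_[p]) * x i}

section Companion

/-- The block companion endomorphism of `v₀ + v₁ y + v₂ y ^ 2 + v₃ y ^ 3` for the monic quartic
`y ^ 4 + G₃ y ^ 3 + G₂ y ^ 2 + G₁ y + G₀`; it represents multiplication by `-y`. -/
def companion {R V : Type*} [CommRing R] [AddCommGroup V] [Module R V] (G₀ G₁ G₂ G₃ : V →ₗ[R] V) :
    (V × V × V × V) →ₗ[R] (V × V × V × V) where
  toFun v := (G₀ v.2.2.2, G₁ v.2.2.2 - v.1, G₂ v.2.2.2 - v.2.1, G₃ v.2.2.2 - v.2.2.1)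
  map_add' v w := by ext <;> simp <;> abel
  map_smul' c v := by ext <;> simp [smul_sub]

theorem nonempty_quotient_companion_equiv {R V : Type*} [CommRing R] [AddCommGroup V] [Module R V]
    (G₀ G₁ G₂ G₃ : V →ₗ[R] V) (y : R) :
    Nonempty (((V × V × V × V) ⧸
        LinearMap.range (companion G₀ G₁ G₂ G₃ + y • LinearMap.id)) ≃ₗ[R]
      (V ⧸ LinearMap.range (G₀ + y • G₁ + y ^ 2 • G₂ + y ^ 3 • G₃ + y ^ 4 • LinearMap.id))) := by
  let φ : (V × V × V × V) →ₗ[R] V :=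
    { toFun := fun u => u.1 + y • u.2.1 + y ^ 2 • u.2.2.1 + y ^ 3 • u.2.2.2
      map_add' := fun u w => by simp only [Prod.fst_add, Prod.snd_add]; module
      map_smul' := fun c u => by simp only [Prod.smul_fst, Prod.smul_snd, RingHom.id_apply]; module }
  refine nonempty_quotient_range_equiv_of_surjective _ (Submodule.mkQ _ ∘ₗ φ)
    ((Submodule.mkQ_surjective _).comp fun v => ⟨(v, 0, 0, 0), by simp [φ]⟩) fun w => ?_
  rw [LinearMap.comp_apply, Submodule.mkQ_apply, Submodule.Quotient.mk_eq_zero]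
  constructor
  · rintro ⟨v₃, hv⟩
    simp only [φ, LinearMap.coe_mk, AddHom.coe_mk, LinearMap.add_apply, LinearMap.smul_apply,
      LinearMap.id_apply] at hv
    obtain ⟨u₀, u₁, u₂, u₃⟩ := w
    -- solving the block rows from the bottom upwards
    let v₂ := y • v₃ + G₃ v₃ - u₃
    let v₁ := y • v₂ + G₂ v₃ - u₂
    refine ⟨(y • v₁ + G₁ v₃ - u₁, v₁, v₂, v₃), ?_⟩
    simp only [companion, LinearMap.add_apply, LinearMap.smul_apply, LinearMap.id_apply,
      LinearMap.coe_mk, AddHom.coe_mk, Prod.smul_mk, Prod.mk_add_mk, Prod.mk.injEq, v₁, v₂]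
    refine ⟨?_, by abel, by abel, by abel⟩
    linear_combination (norm := module) hv
  · rintro ⟨⟨v₀, v₁, v₂, v₃⟩, rfl⟩
    refine ⟨v₃, ?_⟩
    simp only [φ, companion, LinearMap.coe_mk, AddHom.coe_mk, LinearMap.add_apply,
      LinearMap.smul_apply, LinearMap.id_apply, Prod.smul_mk, Prod.mk_add_mk]
    module

end Companion

section Realizable

variable {p : ℕ} [Fact p.Prime] {m : ℕ} {x : Fin m → ℤ_[p]}

theorem realizable_of_end {N : Type*} [AddCommGroup N] [Module ℤ_[p] N] [Module.Free ℤ_[p] N]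
    [Module.Finite ℤ_[p] N] {t : Fin m → Multiset ℕ∞} (T : N →ₗ[ℤ_[p]] N)
    (h : ∀ i, IsoParts p (N ⧸ LinearMap.range (T + ((p : ℤ_[p]) * x i) • LinearMap.id)) (t i)) :
    Realizable x t := by
  let b := Module.finBasis ℤ_[p] N
  refine ⟨Module.finrank ℤ_[p] N, LinearMap.toMatrix b b T, fun i => ?_⟩
  obtain ⟨e⟩ := nonempty_quotient_range_equiv
    (LinearMap.toMatrix b b T + ((p : ℤ_[p]) * x i) • 1).mulVecLin
    (T + ((p : ℤ_[p]) * x i) • LinearMap.id) b.equivFun.symm b.equivFun.symm (fun v => by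
      rw [LinearEquiv.symm_apply_eq]
      obtain ⟨w, rfl⟩ := b.equivFun.surjective v
      rw [LinearEquiv.symm_apply_apply, Matrix.mulVecLin_apply, Matrix.add_mulVec,
        Matrix.smul_mulVec, Matrix.one_mulVec]
      have h1 : (LinearMap.toMatrix b b T).mulVec (b.equivFun w) = b.equivFun (T w) :=
        LinearMap.toMatrix_mulVec_repr b b T w
      rw [h1, LinearMap.add_apply, LinearMap.smul_apply, LinearMap.id_apply, map_add, map_smul])
  exact (h i).congr e

theorem Realizable.add {t t' : Fin m → Multiset ℕ∞} (h : Realizable x t) (h' : Realizable x t') :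
    Realizable x fun i => t i + t' i := by
  obtain ⟨n, A, hA⟩ := h
  obtain ⟨n', A', hA'⟩ := h'
  refine realizable_of_end (A.mulVecLin.prodMap A'.mulVecLin) fun i => ?_
  obtain ⟨e⟩ := nonempty_quotient_range_equiv_of_surjective
    (A.mulVecLin.prodMap A'.mulVecLin + ((p : ℤ_[p]) * x i) • LinearMap.id)
    ((Submodule.mkQ (LinearMap.range (A + ((p : ℤ_[p]) * x i) • 1).mulVecLin)).prodMap
      (Submodule.mkQ (LinearMap.range (A' + ((p : ℤ_[p]) * x i) • 1).mulVecLin)))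
    (Function.Surjective.prodMap (Submodule.mkQ_surjective _) (Submodule.mkQ_surjective _))
    (by
      rintro ⟨w, w'⟩
      simp only [LinearMap.prodMap_apply, Prod.mk_eq_zero, Submodule.mkQ_apply,
        Submodule.Quotient.mk_eq_zero, LinearMap.mem_range]
      constructor
      · rintro ⟨⟨v, rfl⟩, ⟨v', rfl⟩⟩
        exact ⟨(v, v'), by simp⟩
      · rintro ⟨⟨v, v'⟩, h⟩
        simp only [LinearMap.add_apply, LinearMap.prodMap_apply, LinearMap.smul_apply,
          LinearMap.id_apply, Prod.smul_mk, Prod.mk_add_mk, Prod.mk.injEq] at h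
        exact ⟨⟨v, by simp [← h.1]⟩,
          ⟨v', by simp [← h.2]⟩⟩)
  exact ((hA i).prod (hA' i)).congr e

theorem realizable_zero : Realizable x fun _ => 0 :=
  ⟨0, 0, fun _ => IsoParts.of_subsingleton⟩

/-- Matrices whose entries are polynomials in `p x_i` have cokernels of the form
`cok (A + p x_i)`: adding a monic quartic that vanishes at all `p x_i` makes the matrix polynomial
monic, and `A` is its companion matrix. -/
theorem realizable_of_mem_polyValues (hm : m ≤ 4) {ι : Type} [Fintype ι] [DecidableEq ι]
    (M : Fin m → Matrix ι ι ℤ_[p]) (hM : ∀ a b, (fun i => M i a b) ∈ polyValues x)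
    {t : Fin m → Multiset ℕ∞}
    (ht : ∀ i, IsoParts p ((ι → ℤ_[p]) ⧸ LinearMap.range (M i).mulVecLin) (t i)) :
    Realizable x t := by
  let D : Polynomial ℤ_[p] := Polynomial.X ^ (4 - m) *
    ∏ i, (Polynomial.X - Polynomial.C ((p : ℤ_[p]) * x i))
  have hDm : D.Monic := (Polynomial.monic_X_pow _).mul
    (Polynomial.monic_prod_of_monic _ _ fun i _ => Polynomial.monic_X_sub_C _)
  have hDd : D.natDegree = 4 := by
    rw [Polynomial.Monic.natDegree_mul (Polynomial.monic_X_pow _)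
      (Polynomial.monic_prod_of_monic _ _ fun i _ => Polynomial.monic_X_sub_C _),
      Polynomial.natDegree_X_pow, Polynomial.natDegree_prod_of_monic _ _
        (fun i _ => Polynomial.monic_X_sub_C _)]
    simp only [Polynomial.natDegree_X_sub_C, Finset.sum_const, Finset.card_univ, Fintype.card_fin,
      smul_eq_mul, mul_one]
    omega
  have hD0 : ∀ i, D.eval ((p : ℤ_[p]) * x i) = 0 := by
    intro i
    rw [Polynomial.eval_mul, Polynomial.eval_prod,
      Finset.prod_eq_zero (Finset.mem_univ i) (by simp), mul_zero]
  have hf : ∀ a b, ∃ f : Polynomial ℤ_[p], f.natDegree < 4 ∧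
      ∀ i, f.eval ((p : ℤ_[p]) * x i) = M i a b := by
    intro a b
    have := hM a b
    rw [polyValues, Algebra.adjoin_singleton_eq_range_aeval] at this
    obtain ⟨g, hg⟩ := this
    refine ⟨g.modByMonic D, ?_, fun i => ?_⟩
    · rw [← hDd]
      exact Polynomial.natDegree_modByMonic_lt g hDm fun h => by simp [h] at hDd
    · have h1 := congrArg (Polynomial.eval ((p : ℤ_[p]) * x i)) (Polynomial.modByMonic_add_div g D)
      rw [Polynomial.eval_add, Polynomial.eval_mul, hD0, zero_mul, add_zero] at h1
      rw [h1, ← congrFun hg i]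
      simp
  choose f hfd hfe using hf
  let G : ℕ → Matrix ι ι ℤ_[p] := fun k =>
    Matrix.of (fun a b => (f a b).coeff k) + D.coeff k • 1
  refine realizable_of_end (companion (G 0).mulVecLin (G 1).mulVecLin (G 2).mulVecLin
    (G 3).mulVecLin) fun i => ?_
  obtain ⟨e⟩ := nonempty_quotient_companion_equiv (G 0).mulVecLin (G 1).mulVecLin (G 2).mulVecLin
    (G 3).mulVecLin ((p : ℤ_[p]) * x i)
  refine (ht i).congr (e.trans (Submodule.quotEquivOfEq _ _ ?_))
  congr 1
  set y := (p : ℤ_[p]) * x i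
  have hG : G 0 + y • G 1 + y ^ 2 • G 2 + y ^ 3 • G 3 + y ^ 4 • 1 = M i := by
    have hD4 : D.coeff 0 + D.coeff 1 * y + D.coeff 2 * y ^ 2 + D.coeff 3 * y ^ 3 + y ^ 4 = 0 := by
      have h1 := hD0 i
      rw [Polynomial.eval_eq_sum_range, hDd] at h1
      have h2 : D.coeff 4 = 1 := by rw [← hDd]; exact hDm
      simpa [Finset.sum_range_succ, h2] using h1
    ext a b
    have h1 := hfe a b i
    rw [Polynomial.eval_eq_sum_range' (hfd a b)] at h1
    simp only [Finset.sum_range_succ, Finset.sum_range_zero, zero_add, pow_zero, pow_one,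
      mul_one] at h1
    simp only [G, Matrix.add_apply, Matrix.smul_apply, Matrix.of_apply, smul_eq_mul]
    linear_combination h1 + (1 : Matrix ι ι ℤ_[p]) a b * hD4
  rw [← hG]
  refine LinearMap.ext fun v => ?_
  simp only [LinearMap.add_apply, LinearMap.smul_apply, Matrix.mulVecLin_apply, LinearMap.id_apply,
    Matrix.add_mulVec, Matrix.smul_mulVec, Matrix.one_mulVec]

end Realizable

/-! ### The elementary tuples -/

section Atoms

variable {p : ℕ} [Fact p.Prime] {m : ℕ} {x : Fin m → ℤ_[p]}

theorem const_mem_polyValues (c : ℤ_[p]) : (fun _ => c) ∈ polyValues x :=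
  (polyValues x).algebraMap_mem c

theorem sub_mem_polyValues (k : Fin m) :
    (fun i => (p : ℤ_[p]) * (x i - x k)) ∈ polyValues x := by
  have h := (polyValues x).sub_mem (Algebra.self_mem_adjoin_singleton ℤ_[p]
    (fun i => (p : ℤ_[p]) * x i)) (const_mem_polyValues ((p : ℤ_[p]) * x k))
  convert h using 1
  funext i
  simp [mul_sub]

theorem prod_mem_polyValues (T : Finset (Fin m)) :
    (fun i => ∏ k ∈ T, (p : ℤ_[p]) * (x i - x k)) ∈ polyValues x := by
  have h := (polyValues x).prod_mem (t := T) fun k _ => sub_mem_polyValues (x := x) k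
  convert h using 1
  funext i
  simp

/-- Lagrange interpolation at the points `p x_i`: multiples of `p ^ (m - 1)` are interpolated by
polynomials with coefficients in `ℤ_p`. -/
theorem pow_mul_mem_polyValues (hx : DistinctModP x) {e : ℕ} (he : m ≤ e + 1)
    (w : Fin m → ℤ_[p]) : (fun i => (p : ℤ_[p]) ^ e * w i) ∈ polyValues x := by
  classical
  have hu : ∀ k, IsUnit (∏ j ∈ Finset.univ.erase k, (x k - x j)) := fun k => by
    rw [IsUnit.prod_iff]
    exact fun j hj => hx.isUnit_sub (Finset.ne_of_mem_erase hj).symm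
  choose u hu using hu
  have h := (polyValues x).sum_mem (t := Finset.univ) fun k _ => (polyValues x).mul_mem
    (const_mem_polyValues (((u k)⁻¹ : ℤ_[p]ˣ).val * w k * (p : ℤ_[p]) ^ (e + 1 - m)))
    (prod_mem_polyValues (Finset.univ.erase k))
  convert h using 1
  funext i
  rw [Finset.sum_apply, Finset.sum_eq_single i]
  · have hc : (Finset.univ.erase i).card = m - 1 := by
      rw [Finset.card_erase_of_mem (Finset.mem_univ i), Finset.card_univ, Fintype.card_fin]
    have hp : (p : ℤ_[p]) ^ e = (p : ℤ_[p]) ^ (e + 1 - m) * (p : ℤ_[p]) ^ (m - 1) := by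
      rw [← pow_add]
      congr 1
      have := i.pos
      omega
    simp only [Pi.mul_apply]
    rw [Finset.prod_mul_distrib, Finset.prod_const, hc, ← hu i, hp]
    have := (u i).inv_mul
    linear_combination (-(w i * (p : ℤ_[p]) ^ (e + 1 - m) * (p : ℤ_[p]) ^ (m - 1))) * this
  · intro k _ hk
    rw [Pi.mul_apply, Finset.prod_eq_zero (Finset.mem_erase.2 ⟨hk.symm, Finset.mem_univ i⟩)
      (by simp), mul_zero]
  · simp

theorem exists_primePow_eq_mul {e : ℕ} {q : ℕ∞} (h : (e : ℕ∞) ≤ q) :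
    ∃ w, primePow p q = (p : ℤ_[p]) ^ e * w :=
  (pow_dvd_primePow_iff e q).2 h

theorem primePow_one : primePow p 1 = (p : ℤ_[p]) := by
  simpa using primePow_coe (p := p) 1

/-- A matrix with an equivalent diagonal form has the cokernel that the diagonal describes. -/
theorem IsoParts.of_mul_eq_diagonal {ι : Type} [Fintype ι] [DecidableEq ι] {M : Matrix ι ι ℤ_[p]}
    (U V : Matrix ι ι ℤ_[p]) (hU : IsUnit U.det) (hV : IsUnit V.det) {d : ι → ℤ_[p]}
    (h : U * M * V = Matrix.diagonal d) {q : ι → ℕ∞}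
    (hd : ∀ k, Associated (d k) (primePow p (q k))) :
    IsoParts p ((ι → ℤ_[p]) ⧸ LinearMap.range M.mulVecLin) (Finset.univ.val.map q) := by
  obtain ⟨e⟩ := nonempty_quotient_range_equiv M.mulVecLin (Matrix.diagonal d).mulVecLin
    (Matrix.toLin'OfInv (M := V) (M' := V⁻¹) (Matrix.mul_nonsing_inv V hV)
        (Matrix.nonsing_inv_mul V hV))
    (Matrix.toLin'OfInv (M := U⁻¹) (M' := U) (Matrix.nonsing_inv_mul U hU)
        (Matrix.mul_nonsing_inv U hU)) (fun v => by
      change U.mulVec (M.mulVec v) = (Matrix.diagonal d).mulVec (V⁻¹.mulVec v)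
      rw [← h, Matrix.mulVec_mulVec, Matrix.mulVec_mulVec, Matrix.mul_assoc _ V,
        Matrix.mul_nonsing_inv V hV, Matrix.mul_one])
  let φ : (ι → ℤ_[p]) →ₗ[ℤ_[p]] ((k : ι) → ℤ_[p] ⧸ Ideal.span {primePow p (q k)}) :=
    LinearMap.pi fun k => Submodule.mkQ _ ∘ₗ LinearMap.proj k
  have hφ : Function.Surjective φ := by
    intro w
    choose r hr using fun k => Submodule.Quotient.mk_surjective _ (w k)
    exact ⟨r, funext hr⟩
  obtain ⟨e'⟩ := nonempty_quotient_range_equiv_of_surjective (Matrix.diagonal d).mulVecLin φ hφ (by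
    intro w
    have h1 : φ w = 0 ↔ ∀ k, d k ∣ w k := by
      rw [funext_iff]
      refine forall_congr' fun k => ?_
      rw [(hd k).dvd_iff_dvd_left, ← Ideal.mem_span_singleton]
      exact Submodule.Quotient.mk_eq_zero _
    rw [h1]
    constructor
    · intro h
      choose v hv using h
      refine ⟨v, funext fun k => ?_⟩
      rw [Matrix.mulVecLin_apply, Matrix.mulVec_diagonal, hv]
    · rintro ⟨v, rfl⟩ k
      rw [Matrix.mulVecLin_apply, Matrix.mulVec_diagonal]
      exact dvd_mul_right _ _)
  exact ⟨ι, inferInstance, q, rfl, ⟨e.trans e'⟩⟩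

theorem realizable_singleton (hm : m ≤ 4) {g : Fin m → ℤ_[p]} (hg : g ∈ polyValues x)
    {q : Fin m → ℕ∞} (h : ∀ i, Associated (g i) (primePow p (q i))) :
    Realizable x fun i => {q i} := by
  refine realizable_of_mem_polyValues hm (ι := Unit) (fun i => Matrix.diagonal fun _ => g i)
    (fun a b => by simpa using hg) fun i => ?_
  exact IsoParts.of_mul_eq_diagonal (q := fun _ => q i) 1 1 (by simp) (by simp)
    (by rw [Matrix.one_mul, Matrix.mul_one]) fun _ => h i

theorem realizable_of_large (hm : m ≤ 4) (hx : DistinctModP x) {q : Fin m → ℕ∞}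
    (hq : ∀ i, ((m - 1 : ℕ) : ℕ∞) ≤ q i) : Realizable x fun i => {q i} := by
  choose w hw using fun i => exists_primePow_eq_mul (p := p) (hq i)
  refine realizable_singleton hm (pow_mul_mem_polyValues hx (by omega : m ≤ m - 1 + 1) w)
    fun i => ?_
  rw [hw]

/-- A scalar polynomial of degree at most `m - 2` in `p x`, with zeros at the points of `T`. -/
theorem realizable_of_zeros (hm : m ≤ 4) (hx : DistinctModP x) (T : Finset (Fin m))
    (hT : T.card + 2 ≤ m) {q : Fin m → ℕ∞} (hq : ∀ i ∈ T, ((m - 1 : ℕ) : ℕ∞) ≤ q i)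
    (hq' : ∀ i ∉ T, q i = ((m - 2 : ℕ) : ℕ∞)) : Realizable x fun i => {q i} := by
  classical
  choose w hw using fun i : T => exists_primePow_eq_mul (p := p) (hq i i.2)
  refine realizable_singleton hm ((polyValues x).add_mem ((polyValues x).mul_mem
    (const_mem_polyValues ((p : ℤ_[p]) ^ (m - 2 - T.card))) (prod_mem_polyValues T))
    (pow_mul_mem_polyValues hx (by omega : m ≤ m - 1 + 1)
      fun i => if h : i ∈ T then w ⟨i, h⟩ else 0)) fun i => ?_
  simp only [Pi.add_apply, Pi.mul_apply]
  by_cases hi : i ∈ T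
  · rw [dif_pos hi, ← hw ⟨i, hi⟩, Finset.prod_eq_zero hi (by simp), mul_zero, zero_add]
  · rw [dif_neg hi, mul_zero, add_zero, hq' i hi, primePow_coe, Finset.prod_mul_distrib,
      Finset.prod_const, ← mul_assoc, ← pow_add, Nat.sub_add_cancel (by omega)]
    refine associated_mul_unit_left _ _ ?_
    rw [IsUnit.prod_iff]
    exact fun j hj => hx.isUnit_sub fun h => hi (h ▸ hj)

end Atoms

section FourPointAtoms

variable {p : ℕ} [Fact p.Prime] {x : Fin 4 → ℤ_[p]}

theorem realizable_one : Realizable x fun _ => {1} := by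
  refine realizable_singleton le_rfl (const_mem_polyValues (p : ℤ_[p])) fun i => ?_
  rw [primePow_one]

/-- The scalar linear polynomial `p (x - x_i) + c`, where `c` is divisible by `p ^ 2`. -/
theorem realizable_linear (hx : DistinctModP x) (i : Fin 4) {q : Fin 4 → ℕ∞}
    (hq : ((2 : ℕ) : ℕ∞) ≤ q i) (hq' : ∀ j, j ≠ i → q j = 1) : Realizable x fun i => {q i} := by
  obtain ⟨w, hw⟩ := exists_primePow_eq_mul (p := p) hq
  refine realizable_singleton le_rfl ((polyValues x).add_mem (sub_mem_polyValues i)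
    (const_mem_polyValues (primePow p (q i)))) fun j => ?_
  simp only [Pi.add_apply]
  by_cases hj : j = i
  · subst hj
    simp
  · have h1 : primePow p (q j) = p := by
      rw [hq' j hj, primePow_one]
    rw [h1, hw, pow_two, mul_assoc, ← mul_add]
    refine associated_mul_unit_left _ _ ?_
    rw [isUnit_iff_toZMod_ne_zero]
    simpa [sub_eq_zero] using hx.ne hj

theorem realizable_pair {M : Fin 4 → Matrix (Fin 2) (Fin 2) ℤ_[p]} {q q' : Fin 4 → ℕ∞}
    (h00 : (fun i => M i 0 0) ∈ polyValues x) (h01 : (fun i => M i 0 1) ∈ polyValues x)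
    (h10 : (fun i => M i 1 0) ∈ polyValues x) (h11 : (fun i => M i 1 1) ∈ polyValues x)
    (h : ∀ i, ∃ U V : Matrix (Fin 2) (Fin 2) ℤ_[p], IsUnit U.det ∧ IsUnit V.det ∧
      ∃ d d' : ℤ_[p], U * M i * V = !![d, 0; 0, d'] ∧ Associated d (primePow p (q i)) ∧
        Associated d' (primePow p (q' i))) :
    Realizable x fun i => {q i} + {q' i} := by
  refine realizable_of_mem_polyValues le_rfl M (fun a b => ?_) fun i => ?_
  · fin_cases a <;> fin_cases b <;> assumption
  · obtain ⟨U, V, hU, hV, d, d', hd, h0, h1⟩ := h i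
    refine IsoParts.of_mul_eq_diagonal (q := ![q i, q' i]) (d := ![d, d']) U V hU hV ?_ ?_
    · rw [hd]
      ext a b
      fin_cases a <;> fin_cases b <;> rfl
    · intro k
      fin_cases k
      · exact h0
      · exact h1

/-- The matrix polynomial `[[y - y_a, p], [p ^ 3 w, (y - y_b) (y - y_c)]]` in `y = p x`, where
`a, b, c` are the indices other than `i`. Divided by `p` it has rank one modulo `p` everywhere, and
eliminating the entry `p` leaves `p ^ 3 w` minus `p ^ 2` times the monic cubic in `x` with zeros
`x_a, x_b, x_c`. -/
theorem realizable_cubic_pair (hx : DistinctModP x) (i : Fin 4) {q : Fin 4 → ℕ∞} (hq : q i = 2)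
    (hq' : ∀ j, j ≠ i → ((3 : ℕ) : ℕ∞) ≤ q j) : Realizable x fun j => {1} + {q j} := by
  have h3 : ∀ j, ∃ w, if j = i then w = 0 else primePow p (q j) = (p : ℤ_[p]) ^ 3 * w := by
    intro j
    by_cases hj : j = i
    · exact ⟨0, by rw [if_pos hj]⟩
    · simpa only [if_neg hj] using exists_primePow_eq_mul (p := p) (hq' j hj)
  choose w hw using h3
  let a := i.succAbove 0
  let b := i.succAbove 1
  let c := i.succAbove 2
  refine realizable_pair (M := fun j => !![(p : ℤ_[p]) * (x j - x a), (p : ℤ_[p]);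
    (p : ℤ_[p]) ^ 3 * w j, ((p : ℤ_[p]) * (x j - x b)) * ((p : ℤ_[p]) * (x j - x c))])
    (sub_mem_polyValues a) (const_mem_polyValues _) (pow_mul_mem_polyValues hx (by norm_num) w)
    ((polyValues x).mul_mem (sub_mem_polyValues b) (sub_mem_polyValues c)) fun j => ?_
  refine ⟨!![1, 0; -((p : ℤ_[p]) * ((x j - x b) * (x j - x c))), 1], !![0, 1; 1, -(x j - x a)],
    by simp, by simp [Matrix.det_fin_two], p, (p : ℤ_[p]) ^ 3 * w j -
      (p : ℤ_[p]) ^ 2 * ((x j - x a) * ((x j - x b) * (x j - x c))), ?_, ?_, ?_⟩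
  · ext k l
    fin_cases k <;> fin_cases l <;> simp [Matrix.mul_apply, Fin.sum_univ_two] <;> ring
  · rw [primePow_one]
  · by_cases hj : j = i
    · subst hj
      have h1 := hw j
      rw [if_pos rfl] at h1
      have h2 : primePow p (q j) = (p : ℤ_[p]) ^ 2 := by
        rw [hq]
        exact primePow_coe 2
      rw [h1, h2, mul_zero, zero_sub, Associated.neg_left_iff]
      exact associated_mul_unit_left _ _ ((hx.isUnit_sub (Fin.succAbove_ne j 0).symm).mul
        ((hx.isUnit_sub (Fin.succAbove_ne j 1).symm).mul
          (hx.isUnit_sub (Fin.succAbove_ne j 2).symm)))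
    · have h1 := hw j
      rw [if_neg hj] at h1
      have h2 : (x j - x a) * ((x j - x b) * (x j - x c)) = 0 := by
        obtain ⟨s, rfl⟩ := Fin.exists_succAbove_eq hj
        fin_cases s <;> simp [a, b, c]
      rw [h2, mul_zero, sub_zero, h1]

/-- The matrix polynomial `[[y - y_i, p ^ 2], [p ^ 2, p ^ 3 w]]` in `y = p x`. -/
theorem realizable_linear_pair (hx : DistinctModP x) (i : Fin 4) {q : Fin 4 → ℕ∞} (hq : q i = 2)
    (hq' : ∀ j, j ≠ i → ((3 : ℕ) : ℕ∞) ≤ q j) :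
    Realizable x fun j => {if j = i then 2 else 1} + {q j} := by
  have h3 : ∀ j, ∃ w v, if j = i then w = 0 else (x j - x i) * v = 1 ∧
      primePow p (q j) = (p : ℤ_[p]) ^ 3 * (w - v) := by
    intro j
    by_cases hj : j = i
    · exact ⟨0, 0, by rw [if_pos hj]⟩
    · obtain ⟨w, hw⟩ := exists_primePow_eq_mul (p := p) (hq' j hj)
      obtain ⟨v, hv⟩ := (hx.isUnit_sub hj).exists_right_inv
      exact ⟨w + v, v, by rw [if_neg hj, add_sub_cancel_right]; exact ⟨hv, hw⟩⟩
  choose w v hw using h3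
  refine realizable_pair (q := fun j => if j = i then 2 else 1)
    (M := fun j => !![(p : ℤ_[p]) * (x j - x i), (p : ℤ_[p]) ^ 2;
      (p : ℤ_[p]) ^ 2, (p : ℤ_[p]) ^ 3 * w j])
    (sub_mem_polyValues i) (const_mem_polyValues _) (const_mem_polyValues _)
    (pow_mul_mem_polyValues hx (by norm_num) w) fun j => ?_
  have h2 : primePow p 2 = (p : ℤ_[p]) ^ 2 := primePow_coe 2
  by_cases hj : j = i
  · subst hj
    have h1 := hw j
    rw [if_pos rfl] at h1
    refine ⟨1, !![0, 1; 1, 0], by simp, by simp [Matrix.det_fin_two], (p : ℤ_[p]) ^ 2,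
      (p : ℤ_[p]) ^ 2, ?_, ?_, ?_⟩
    · rw [h1, Matrix.one_mul]
      ext k l
      fin_cases k <;> fin_cases l <;> simp [Matrix.mul_apply, Fin.sum_univ_two]
    · rw [if_pos rfl, h2]
    · rw [hq, h2]
  · have h1 := hw j
    rw [if_neg hj] at h1
    obtain ⟨hv, h1⟩ := h1
    refine ⟨!![1, 0; -((p : ℤ_[p]) * v j), 1], !![1, -((p : ℤ_[p]) * v j); 0, 1], by simp, by simp,
      (p : ℤ_[p]) * (x j - x i), (p : ℤ_[p]) ^ 3 * (w j - v j), ?_, ?_, ?_⟩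
    · ext k l
      fin_cases k <;> fin_cases l <;> simp [Matrix.mul_apply, Fin.sum_univ_two]
      · linear_combination (-(p : ℤ_[p]) ^ 2) * hv
      · linear_combination (-(p : ℤ_[p]) ^ 2) * hv
      · linear_combination ((p : ℤ_[p]) ^ 3 * v j) * hv
    · rw [if_neg hj, primePow_one]
      exact associated_mul_unit_left _ _ (hx.isUnit_sub hj)
    · rw [h1]

end FourPointAtoms

/-! ### Decomposition of the numerical data -/

section Numerical

/-- A vector `b` with entries at most `s` and with no entry exceeding the sum of the others is a
sum of `s` indicator vectors of sets that are empty or have at least two elements. -/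
theorem indicator_induction {n : ℕ} {Q : (Fin n → ℕ) → ℕ → Prop} (h0 : Q 0 0)
    (hZ : ∀ b s, Q b s → Q b (s + 1))
    (hS : ∀ (S : Finset (Fin n)) b s, 2 ≤ S.card → Q b s →
      Q (fun i => b i + if i ∈ S then 1 else 0) (s + 1)) :
    ∀ s b, (∀ i, b i ≤ s) → (∀ i, 2 * b i ≤ ∑ k, b k) → Q b s := by
  intro s
  induction s with
  | zero =>
    intro b hb _
    obtain rfl : b = 0 := funext fun i => Nat.le_zero.1 (hb i)
    exact h0
  | succ s ih =>
    intro b hb hsum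
    by_cases hlt : ∀ i, b i ≤ s
    · exact hZ _ _ (ih b hlt hsum)
    push Not at hlt
    obtain ⟨i, hi⟩ := hlt
    have hi : b i = s + 1 := le_antisymm (hb i) hi
    -- the removed set contains all maximal entries, and at least two positive ones
    obtain ⟨S, hS2, hSpos, hSmax, hSsum⟩ : ∃ S : Finset (Fin n), 2 ≤ S.card ∧ (∀ j ∈ S, 0 < b j) ∧
        (∀ j, b j = s + 1 → j ∈ S) ∧ 2 * s + S.card ≤ ∑ k, b k := by
      by_cases hc : 2 ≤ (Finset.univ.filter fun j => b j = s + 1).card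
      · refine ⟨_, hc, fun j hj => ?_, fun j hj => by simpa using hj, ?_⟩
        · rw [(Finset.mem_filter.1 hj).2]
          exact Nat.succ_pos s
        · have h1 : (Finset.univ.filter fun j => b j = s + 1).card * (s + 1) ≤ ∑ k, b k := by
            rw [← smul_eq_mul]
            refine (Finset.card_nsmul_le_sum _ b (s + 1) fun j hj => ?_).trans
              (Finset.sum_le_sum_of_subset (Finset.filter_subset _ _))
            exact (Finset.mem_filter.1 hj).2.ge
          nlinarith
      · have h1 : ∃ j, j ≠ i ∧ 0 < b j := by
          by_contra! h
          have h2 : ∑ k, b k = b i := Finset.sum_eq_single i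
            (fun j _ hj => Nat.le_zero.1 (h j hj)) (by simp)
          have := hsum i
          omega
        obtain ⟨j, hj, hbj⟩ := h1
        refine ⟨{i, j}, by rw [Finset.card_pair hj.symm], ?_, fun k hk => ?_, ?_⟩
        · intro k hk
          rcases Finset.mem_insert.1 hk with rfl | hk
          · omega
          · rwa [Finset.mem_singleton.1 hk]
        · by_contra hne
          refine hc (Finset.one_lt_card.2 ⟨i, by simpa using hi, k, by simpa using hk, ?_⟩)
          rintro rfl
          exact hne (Finset.mem_insert_self _ _)
        · rw [Finset.card_pair hj.symm]
          have := hsum i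
          omega
    have hdec : b = fun i => (b i - if i ∈ S then 1 else 0) + if i ∈ S then 1 else 0 := by
      funext j
      have := hSpos j
      split_ifs with h
      · have := this h
        omega
      · omega
    have hcard : ∑ k, b k = (∑ k, (b k - if k ∈ S then 1 else 0)) + S.card := by
      conv_lhs => rw [hdec]
      rw [Finset.sum_add_distrib]
      simp
    have hle : ∀ j, (b j - if j ∈ S then 1 else 0) ≤ s := by
      intro j
      have h1 := hb j
      have h2 := hSmax j
      split_ifs with h
      · omega
      · have : b j ≠ s + 1 := fun h' => h (h2 h')
        omega
    rw [hdec]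
    refine hS S _ s hS2 (ih _ hle fun j => ?_)
    have := hle j
    omega

/-- The numerical conditions for four points, on the numbers `a i` of parts `1`, the numbers `b i`
of parts `1` or `2`, and the common number `s` of parts. -/
def FourPointCondition (a b : Fin 4 → ℕ) (s : ℕ) : Prop :=
  (∀ i, a i ≤ b i) ∧ (∀ i, b i ≤ s) ∧ (∀ i, 3 * a i ≤ ∑ k, a k) ∧
    ∀ i j, a i + 2 * b j ≤ ∑ k, b k

theorem FourPointCondition.of_bounds {a b : Fin 4 → ℕ} {s α : ℕ} (h₁ : ∀ i, a i ≤ b i)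
    (h₂ : ∀ i, a i ≤ α) (h₃ : ∀ i, b i ≤ s) (h₄ : 3 * α ≤ ∑ k, a k)
    (h₅ : α + 2 * s ≤ ∑ k, b k) : FourPointCondition a b s := by
  refine ⟨h₁, h₃, fun i => ?_, fun i j => ?_⟩
  · have := h₂ i
    omega
  · have := h₂ i
    have := h₃ j
    omega

theorem sum_ite_eq_zero_one (i : Fin 4) : ∑ j, (if j = i then 0 else 1) = 3 := by
  fin_cases i <;> rfl

theorem sum_one_add_ite (i : Fin 4) : ∑ j, (1 + if j = i then 1 else 0) = 5 := by
  fin_cases i <;> rfl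

theorem le_sum_four {a : Fin 4 → ℕ} {i j : Fin 4} (hij : j ≠ i) {α : ℕ} (h : ∀ k, a k ≤ α) :
    ∑ k, a k ≤ a i + a j + 2 * α := by
  have h0 := h 0
  have h1 := h 1
  have h2 := h 2
  have h3 := h 3
  rw [Fin.sum_univ_four]
  fin_cases i <;> fin_cases j <;> simp at hij ⊢ <;> omega

theorem add_sum_le_sum_add_four {a b : Fin 4 → ℕ} {i j : Fin 4} (hij : j ≠ i)
    (h : ∀ k, a k ≤ b k) : b i + b j + ∑ k, a k ≤ ∑ k, b k + (a i + a j) := by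
  have h0 := h 0
  have h1 := h 1
  have h2 := h 2
  have h3 := h 3
  rw [Fin.sum_univ_four, Fin.sum_univ_four]
  fin_cases i <;> fin_cases j <;> simp at hij ⊢ <;> omega

/-- The numerical data satisfying the four point conditions are sums of elementary ones. With
`α = max a` one removes: nothing from `a` and `b` while `s` exceeds `max b`; indicators if `a = 0`;
otherwise an elementary datum lowering `α` by one. If some `a i < α`, this datum has `a i`
unchanged, and otherwise it lowers all `a i`. In both cases two columns are removed at once exactly
when `α + 2 s ≤ ∑ b` is tight and the maximum of `b` is attained at the wrong place. -/
theorem four_point_induction {Q : (Fin 4 → ℕ) → (Fin 4 → ℕ) → ℕ → Prop} (h0 : Q 0 0 0)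
    (hZ : ∀ a b s, Q a b s → Q a b (s + 1))
    (hS : ∀ (S : Finset (Fin 4)) a b s, 2 ≤ S.card → Q a b s →
      Q a (fun i => b i + if i ∈ S then 1 else 0) (s + 1))
    (hA : ∀ i a b s, Q a b s → Q (fun j => a j + if j = i then 0 else 1)
      (fun j => b j + if j = i then 0 else 1) (s + 1))
    (hA' : ∀ i a b s, Q a b s → Q (fun j => a j + if j = i then 0 else 1)
      (fun j => b j + 1) (s + 1))
    (hE : ∀ a b s, Q a b s → Q (fun j => a j + 1) (fun j => b j + 1) (s + 1))
    (hC : ∀ i a b s, Q a b s → Q (fun j => a j + 1)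
      (fun j => b j + (1 + if j = i then 1 else 0)) (s + 2))
    (hD : ∀ i a b s, Q a b s → Q (fun j => a j + if j = i then 0 else 1)
      (fun j => b j + (1 + if j = i then 1 else 0)) (s + 2)) :
    ∀ s a b, FourPointCondition a b s → Q a b s := by
  intro s
  induction s using Nat.strong_induction_on with
  | _ s ih =>
  rintro a b ⟨hab, hbs, ha, hb⟩
  by_cases ha0 : ∀ i, a i = 0
  · obtain rfl : a = 0 := funext ha0
    refine indicator_induction (Q := Q 0) h0 (hZ 0) (fun S b s => hS S 0 b s) s b hbs fun i => ?_
    simpa using hb 0 i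
  push Not at ha0
  obtain ⟨i₀, hi₀⟩ := ha0
  obtain ⟨k, hk⟩ := Finite.exists_max a
  have hpos : 0 < a k := (Nat.pos_of_ne_zero hi₀).trans_le (hk i₀)
  have hks : a k ≤ s := (hab k).trans (hbs k)
  by_cases hlt : ∀ i, b i ≤ s - 1
  · obtain ⟨r, rfl⟩ : ∃ r, s = r + 1 := ⟨s - 1, by omega⟩
    exact hZ _ _ _ (ih r (by omega) a b ⟨hab, hlt, ha, hb⟩)
  push Not at hlt
  obtain ⟨β, hβ⟩ := hlt
  have hβs : b β = s := by
    have := hbs β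
    omega
  have hB : a k + 2 * s ≤ ∑ j, b j := hβs ▸ hb k β
  have hA3 := ha k
  by_cases hne : ∃ i, a i < a k
  · obtain ⟨i, hi⟩ := hne
    have hap : ∀ j, j ≠ i → 0 < a j := fun j hj => by
      have := le_sum_four hj hk
      omega
    have hda : a = fun j => (a j - if j = i then 0 else 1) + if j = i then 0 else 1 := by
      funext j
      have := hap j
      split_ifs with h
      · omega
      · have := this h
        omega
    have hsa : ∑ j, a j = (∑ j, (a j - if j = i then 0 else 1)) + 3 := by
      conv_lhs => rw [hda]
      rw [Finset.sum_add_distrib, sum_ite_eq_zero_one]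
    have hle : ∀ j, (a j - if j = i then 0 else 1) ≤ a k - 1 := by
      intro j
      have := hk j
      split_ifs with h
      · subst h
        omega
      · omega
    by_cases hbi : b i < s
    · obtain ⟨r, rfl⟩ : ∃ r, s = r + 1 := ⟨s - 1, by omega⟩
      have hdb : b = fun j => (b j - if j = i then 0 else 1) + if j = i then 0 else 1 := by
        funext j
        have := hap j
        have := hab j
        split_ifs with h
        · omega
        · have := hap j h
          omega
      have hsb : ∑ j, b j = (∑ j, (b j - if j = i then 0 else 1)) + 3 := by
        conv_lhs => rw [hdb]
        rw [Finset.sum_add_distrib, sum_ite_eq_zero_one]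
      rw [hda, hdb]
      refine hA i _ _ r (ih r (by omega) _ _ (.of_bounds (α := a k - 1) ?_ hle ?_ ?_ ?_))
      · intro j
        have := hab j
        omega
      · intro j
        have := hbs j
        split_ifs with h
        · subst h
          omega
        · omega
      · omega
      · omega
    have hbi : b i = s := le_antisymm (hbs i) (not_lt.1 hbi)
    by_cases hslack : a k + 2 * s + 1 ≤ ∑ j, b j
    · obtain ⟨r, rfl⟩ : ∃ r, s = r + 1 := ⟨s - 1, by omega⟩
      have hbp : ∀ j, 0 < b j := fun j => by
        by_cases h : j = i
        · subst h
          omega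
        · exact (hap j h).trans_le (hab j)
      have hdb : b = fun j => (b j - 1) + 1 := by
        funext j
        have := hbp j
        omega
      have hsb : ∑ j, b j = (∑ j, (b j - 1)) + 4 := by
        conv_lhs => rw [hdb]
        rw [Finset.sum_add_distrib]
        simp
      rw [hda, hdb]
      refine hA' i _ _ r (ih r (by omega) _ _ (.of_bounds (α := a k - 1) ?_ hle ?_ ?_ ?_))
      · intro j
        have := hab j
        split_ifs with h
        · subst h
          omega
        · omega
      · intro j
        have := hbs j
        omega
      · omega
      · omega
    · have hbj : ∀ j, j ≠ i → b j < s := by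
        intro j hj
        have h1 := add_sum_le_sum_add_four hj hab
        have h2 := hk j
        have h3 := hbs j
        omega
      have hks' : a k < s := by
        have h1 := add_sum_le_sum_add_four (b := b) (j := i + 1) (i := i) (by simp) hab
        have h2 := hab (i + 1)
        omega
      obtain ⟨r, rfl⟩ : ∃ r, s = r + 2 := ⟨s - 2, by omega⟩
      have hdb : b = fun j => (b j - (1 + if j = i then 1 else 0)) +
          (1 + if j = i then 1 else 0) := by
        funext j
        have := hab j
        split_ifs with h
        · subst h
          omega
        · have := hap j h
          omega
      have hsb : ∑ j, b j = (∑ j, (b j - (1 + if j = i then 1 else 0))) + 5 := by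
        conv_lhs => rw [hdb]
        rw [Finset.sum_add_distrib, sum_one_add_ite]
      rw [hda, hdb]
      refine hD i _ _ r (ih r (by omega) _ _ (.of_bounds (α := a k - 1) ?_ hle ?_ ?_ ?_))
      · intro j
        have := hab j
        split_ifs with h
        · subst h
          omega
        · omega
      · intro j
        have := hbs j
        split_ifs with h
        · omega
        · have := hbj j h
          omega
      · omega
      · omega
  · push Not at hne
    have hak : ∀ j, a j = a k := fun j => le_antisymm (hk j) (hne j)
    have hA4 : ∑ j, a j = 4 * a k := by
      rw [Finset.sum_congr rfl fun j _ => hak j]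
      simp
    have hda : a = fun j => (a j - 1) + 1 := by
      funext j
      have := hak j
      omega
    have hsa : ∑ j, a j = (∑ j, (a j - 1)) + 4 := by
      conv_lhs => rw [hda]
      rw [Finset.sum_add_distrib]
      simp
    have hle : ∀ j, a j - 1 ≤ a k - 1 := fun j => by rw [hak j]
    by_cases hslack : a k + 2 * s + 1 ≤ ∑ j, b j
    · obtain ⟨r, rfl⟩ : ∃ r, s = r + 1 := ⟨s - 1, by omega⟩
      have hdb : b = fun j => (b j - 1) + 1 := by
        funext j
        have := hab j
        have := hak j
        omega
      have hsb : ∑ j, b j = (∑ j, (b j - 1)) + 4 := by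
        conv_lhs => rw [hdb]
        rw [Finset.sum_add_distrib]
        simp
      rw [hda, hdb]
      refine hE _ _ r (ih r (by omega) _ _ (.of_bounds (α := a k - 1) ?_ hle ?_ ?_ ?_))
      · intro j
        have := hab j
        omega
      · intro j
        have := hbs j
        omega
      · omega
      · omega
    · have hbj : ∀ j, j ≠ β → b j < s := by
        intro j hj
        have h1 := add_sum_le_sum_add_four hj hab
        have h2 := hak j
        have h3 := hak β
        have h4 := hbs j
        omega
      have hks' : a k < s := by
        have h1 := add_sum_le_sum_add_four (b := b) (j := β + 1) (i := β) (by simp) hab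
        have h2 := hab (β + 1)
        have h3 := hak β
        omega
      obtain ⟨r, rfl⟩ : ∃ r, s = r + 2 := ⟨s - 2, by omega⟩
      have hdb : b = fun j => (b j - (1 + if j = β then 1 else 0)) +
          (1 + if j = β then 1 else 0) := by
        funext j
        have := hab j
        have := hak j
        split_ifs with h
        · subst h
          omega
        · omega
      have hsb : ∑ j, b j = (∑ j, (b j - (1 + if j = β then 1 else 0))) + 5 := by
        conv_lhs => rw [hdb]
        rw [Finset.sum_add_distrib, sum_one_add_ite]
      rw [hda, hdb]
      refine hC β _ _ r (ih r (by omega) _ _ (.of_bounds (α := a k - 1) ?_ hle ?_ ?_ ?_))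
      · intro j
        have := hab j
        have := hak j
        split_ifs with h
        · subst h
          omega
        · omega
      · intro j
        have := hbs j
        split_ifs with h
        · omega
        · have := hbj j h
          omega
      · omega
      · omega

end Numerical

/-! ### Sufficiency of the conditions -/

section PartsOfMultisets

theorem Multiset.exists_one_le {t : Multiset ℕ∞} (h0 : 0 ∉ t) (h : 0 < t.card) :
    ∃ q ∈ t, ((1 : ℕ) : ℕ∞) ≤ q := by
  rw [← Multiset.countP_one_le_eq_card h0] at h
  exact Multiset.countP_pos.1 h

theorem Multiset.exists_two_le {t : Multiset ℕ∞} (h0 : 0 ∉ t) (h : t.count 1 < t.card) :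
    ∃ q ∈ t, ((2 : ℕ) : ℕ∞) ≤ q := by
  have h1 := Multiset.count_one_add_countP h0
  have h2 : 0 < t.countP (fun e => ((2 : ℕ) : ℕ∞) ≤ e) := by omega
  exact Multiset.countP_pos.1 h2

theorem Multiset.exists_three_le {t : Multiset ℕ∞} (h0 : 0 ∉ t)
    (h : t.count 1 + t.count 2 < t.card) : ∃ q ∈ t, ((3 : ℕ) : ℕ∞) ≤ q := by
  rw [← Multiset.count_one_add_countP h0, Multiset.countP_le_eq_count_add t 2] at h
  exact Multiset.countP_pos.1 (Nat.pos_of_lt_add_right (n := t.count 2) (by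
    rw [show ((2 : ℕ) : ℕ∞) = 2 from rfl] at h
    exact Nat.lt_of_add_lt_add_left h))

theorem Multiset.singleton_add_singleton_le {α : Type*} {t : Multiset α} {a b : α} (hab : a ≠ b)
    (ha : a ∈ t) (hb : b ∈ t) : {a} + {b} ≤ t := by
  refine (Multiset.le_iff_subset ?_).2 ?_
  · simpa using hab
  · intro c hc
    simp only [Multiset.mem_add, Multiset.mem_singleton] at hc
    rcases hc with rfl | rfl <;> assumption

end PartsOfMultisets

section Sufficiency

variable {p : ℕ} [Fact p.Prime]

/-- A realizable tuple of sub-multisets can be split off. -/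
theorem Realizable.of_le {m : ℕ} {x : Fin m → ℤ_[p]} {t : Fin m → Multiset ℕ∞}
    {u : Fin m → Multiset ℕ∞} (hu : Realizable x u) (hut : ∀ i, u i ≤ t i)
    (h : ∀ t' : Fin m → Multiset ℕ∞, (∀ i, t i = u i + t' i) → Realizable x t') :
    Realizable x t := by
  have h1 : ∀ i, t i = u i + (t i - u i) := fun i => (add_tsub_cancel_of_le (hut i)).symm
  have h2 := hu.add (h _ h1)
  simpa only [← h1] using h2

theorem memC_of_realizable {m : ℕ} {x : Fin m → ℤ_[p]} {H : Fin m → Type*}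
    [∀ i, AddCommGroup (H i)] [∀ i, Module ℤ_[p] (H i)] {t : Fin m → Multiset ℕ∞}
    (h : Realizable x t) (ht : ∀ i, IsoParts p (H i) (t i)) : MemC x H := by
  obtain ⟨n, A, hA⟩ := h
  exact ⟨n, A, fun i => (hA i).unique (ht i)⟩

theorem realizable_of_card_eq {m : ℕ} (hm : m ≤ 2) {x : Fin m → ℤ_[p]} (hx : DistinctModP x)
    (s : ℕ) (t : Fin m → Multiset ℕ∞) (h0 : ∀ i, 0 ∉ t i) (hs : ∀ i, (t i).card = s) :
    Realizable x t := by
  induction s generalizing t with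
  | zero =>
    have : t = fun _ => 0 := funext fun i => Multiset.card_eq_zero.1 (hs i)
    rw [this]
    exact realizable_zero
  | succ s ih =>
    choose q hq hq1 using fun i => Multiset.exists_one_le (h0 i) (by rw [hs i]; exact s.succ_pos)
    refine (realizable_of_large (q := q) (by omega) hx fun i => ?_).of_le
      (fun i => Multiset.singleton_le.2 (hq i)) fun t' ht' => ?_
    · exact le_trans (by exact_mod_cast (by omega : m - 1 ≤ 1)) (hq1 i)
    · refine ih t' (fun i h => h0 i ?_) fun i => ?_
      · rw [ht' i]
        exact Multiset.mem_add.2 (Or.inr h)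
      · have := hs i
        rw [ht' i, Multiset.card_add, Multiset.card_singleton] at this
        omega

theorem realizable_three {x : Fin 3 → ℤ_[p]} (hx : DistinctModP x) {s : ℕ}
    (t : Fin 3 → Multiset ℕ∞) (h0 : ∀ i, 0 ∉ t i) (hs : ∀ i, (t i).card = s)
    (h : ∀ i, 2 * (t i).count 1 ≤ ∑ k, (t k).count 1) : Realizable x t := by
  let Q : (Fin 3 → ℕ) → ℕ → Prop := fun b s => (∀ i, b i ≤ s) ∧ ∀ t : Fin 3 → Multiset ℕ∞,
    (∀ i, 0 ∉ t i) → (∀ i, (t i).count 1 = b i) → (∀ i, (t i).card = s) → Realizable x t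
  suffices hQ : Q (fun i => (t i).count 1) s from hQ.2 t h0 (fun _ => rfl) hs
  have hmem : ∀ {t u t' : Fin 3 → Multiset ℕ∞}, (∀ i, 0 ∉ t i) → (∀ i, t i = u i + t' i) →
      ∀ i, 0 ∉ t' i := fun h0 ht i h' => h0 i (by rw [ht i]; exact Multiset.mem_add.2 (Or.inr h'))
  refine indicator_induction (Q := Q) ⟨fun _ => le_rfl, fun t _ _ hs => ?_⟩ ?_ ?_ s _
    (fun i => (hs i) ▸ Multiset.count_le_card _ _) h
  · have : t = fun _ => 0 := funext fun i => Multiset.card_eq_zero.1 (hs i)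
    rw [this]
    exact realizable_zero
  · rintro b s ⟨hb, ih⟩
    refine ⟨fun i => (hb i).trans s.le_succ, fun t h0 hc hs => ?_⟩
    choose q hq hq2 using fun i => Multiset.exists_two_le (h0 i) (by
      rw [hs i, hc i]; exact Nat.lt_succ_of_le (hb i))
    refine (realizable_of_large (q := q) (by norm_num) hx hq2).of_le
      (fun i => Multiset.singleton_le.2 (hq i)) fun t' ht' =>
        ih t' (hmem h0 ht') (fun i => ?_) fun i => ?_
    · have := hc i
      have h1 : (1 : ℕ∞) ≠ q i := fun h => by
        have := hq2 i
        rw [← h] at this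
        exact absurd this (by decide)
      rw [ht' i, Multiset.count_add, Multiset.count_singleton, if_neg h1] at this
      omega
    · have := hs i
      rw [ht' i, Multiset.card_add, Multiset.card_singleton] at this
      omega
  · rintro S b s hS ⟨hb, ih⟩
    refine ⟨fun i => Nat.add_le_add (hb i) (by split_ifs <;> simp), fun t h0 hc hs => ?_⟩
    beta_reduce at hc
    have hex : ∀ i, ∃ q ∈ t i, if i ∈ S then q = 1 else ((2 : ℕ) : ℕ∞) ≤ q := by
      intro i
      have h1 := hc i
      split_ifs at h1 ⊢ with h
      · exact ⟨1, Multiset.count_pos.1 (by omega), rfl⟩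
      · refine Multiset.exists_two_le (h0 i) ?_
        have := hb i
        rw [h1, hs i]
        omega
    choose q hq hq2 using hex
    have hT : Sᶜ.card + 2 ≤ 3 := by
      rw [Finset.card_compl, Fintype.card_fin]
      have := S.card_le_univ
      rw [Fintype.card_fin] at this
      omega
    refine (realizable_of_zeros (q := q) (by norm_num) hx Sᶜ hT (fun i hi => ?_)
      (fun i hi => ?_)).of_le (fun i => Multiset.singleton_le.2 (hq i)) fun t' ht' =>
        ih t' (hmem h0 ht') (fun i => ?_) fun i => ?_
    · simpa [Finset.mem_compl.1 hi] using hq2 i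
    · have hi : i ∈ S := by simpa using hi
      simpa [hi] using hq2 i
    · have h1 := hc i
      have h2 := hq2 i
      rw [ht' i, Multiset.count_add, Multiset.count_singleton] at h1
      by_cases hi : i ∈ S
      · rw [if_pos hi] at h1 h2
        rw [if_pos h2.symm] at h1
        omega
      · rw [if_neg hi] at h1 h2
        have h3 : 1 ≠ q i := fun h => absurd (h ▸ h2) (by decide)
        rw [if_neg h3] at h1
        omega
    · have := hs i
      rw [ht' i, Multiset.card_add, Multiset.card_singleton] at this
      omega

theorem realizable_four {x : Fin 4 → ℤ_[p]} (hx : DistinctModP x) {s : ℕ}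
    (t : Fin 4 → Multiset ℕ∞) (h0 : ∀ i, 0 ∉ t i) (hs : ∀ i, (t i).card = s)
    (h : FourPointCondition (fun i => (t i).count 1) (fun i => (t i).count 1 + (t i).count 2) s) :
    Realizable x t := by
  let Q : (Fin 4 → ℕ) → (Fin 4 → ℕ) → ℕ → Prop := fun a b s =>
    (∀ i, a i ≤ b i) ∧ (∀ i, b i ≤ s) ∧ ∀ t : Fin 4 → Multiset ℕ∞, (∀ i, 0 ∉ t i) →
      (∀ i, (t i).count 1 = a i) → (∀ i, (t i).count 1 + (t i).count 2 = b i) →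
        (∀ i, (t i).card = s) → Realizable x t
  suffices hQ : Q (fun i => (t i).count 1) (fun i => (t i).count 1 + (t i).count 2) s from
    hQ.2.2 t h0 (fun _ => rfl) (fun _ => rfl) hs
  have h12 : (1 : ℕ∞) ≠ 2 := by decide
  have h3 : ∀ {q : ℕ∞}, ((3 : ℕ) : ℕ∞) ≤ q → q ≠ 1 ∧ q ≠ 2 := fun h =>
    ⟨fun h' => absurd (h' ▸ h) (by decide), fun h' => absurd (h' ▸ h) (by decide)⟩
  -- removing a realizable tuple `u` lowers the counts by those of `u`
  have step : ∀ {a b : Fin 4 → ℕ} {s : ℕ} {t u : Fin 4 → Multiset ℕ∞}, Q a b s →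
      (∀ i, 0 ∉ t i) → Realizable x u → (∀ i, u i ≤ t i) →
      (∀ i, (t i).count 1 = a i + (u i).count 1) →
      (∀ i, (t i).count 1 + (t i).count 2 = b i + ((u i).count 1 + (u i).count 2)) →
      (∀ i, (t i).card = s + (u i).card) → Realizable x t := by
    rintro a b s t u ⟨-, -, ih⟩ h0 hu hut h1 h2 hs
    refine hu.of_le hut fun t' ht' => ih t' (fun i h' => h0 i ?_) (fun i => ?_) (fun i => ?_)
      fun i => ?_
    · rw [ht' i]
      exact Multiset.mem_add.2 (Or.inr h')
    · have := h1 i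
      rw [ht' i, Multiset.count_add] at this
      omega
    · have := h2 i
      rw [ht' i, Multiset.count_add, Multiset.count_add] at this
      omega
    · have := hs i
      rw [ht' i, Multiset.card_add] at this
      omega
  refine four_point_induction (Q := Q) ⟨fun _ => le_rfl, fun _ => le_rfl, fun t _ _ _ hs => ?_⟩
    ?_ ?_ ?_ ?_ ?_ ?_ ?_ s _ _ h
  · have : t = fun _ => 0 := funext fun i => Multiset.card_eq_zero.1 (hs i)
    rw [this]
    exact realizable_zero
  · intro a b s hQ
    refine ⟨hQ.1, fun i => (hQ.2.1 i).trans s.le_succ, fun t h0 ha hb hs => ?_⟩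
    choose q hq hq3 using fun i => Multiset.exists_three_le (h0 i) (by
      rw [hs i, hb i]; exact Nat.lt_succ_of_le (hQ.2.1 i))
    refine step hQ h0 (realizable_of_large (q := q) le_rfl hx hq3)
      (fun i => Multiset.singleton_le.2 (hq i)) (fun i => ?_) (fun i => ?_) fun i => ?_
    · simp [ha i, (h3 (hq3 i)).1.symm]
    · simp [hb i, (h3 (hq3 i)).1.symm, (h3 (hq3 i)).2.symm]
    · simp [hs i]
  · intro S a b s hS hQ
    have hab := hQ.1
    have hbs := hQ.2.1
    refine ⟨fun i => (hab i).trans (Nat.le_add_right _ _),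
      fun i => Nat.add_le_add (hbs i) (by split_ifs <;> simp), fun t h0 ha hb hs => ?_⟩
    beta_reduce at ha hb
    have hex : ∀ i, ∃ q ∈ t i, if i ∈ S then q = 2 else ((3 : ℕ) : ℕ∞) ≤ q := by
      intro i
      have h1 := hb i
      have h2 := ha i
      have h3 := hab i
      have h4 := hbs i
      split_ifs at h1 ⊢ with h
      · exact ⟨2, Multiset.count_pos.1 (by omega), rfl⟩
      · exact Multiset.exists_three_le (h0 i) (by rw [h1, hs i]; omega)
    choose q hq hq2 using hex
    have hT : Sᶜ.card + 2 ≤ 4 := by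
      rw [Finset.card_compl, Fintype.card_fin]
      have := S.card_le_univ
      rw [Fintype.card_fin] at this
      omega
    have hq1 : ∀ i, 1 ≠ q i := by
      intro i
      have := hq2 i
      split_ifs at this
      · rwa [this]
      · exact (h3 this).1.symm
    refine step hQ h0 (realizable_of_zeros (q := q) le_rfl hx Sᶜ hT (fun i hi => ?_)
      (fun i hi => ?_)) (fun i => Multiset.singleton_le.2 (hq i)) (fun i => ?_) (fun i => ?_)
      fun i => ?_
    · simpa [Finset.mem_compl.1 hi] using hq2 i
    · have hi : i ∈ S := by simpa using hi
      simpa [hi] using hq2 i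
    · simp [ha i, hq1 i]
    · have h2 := hq2 i
      rw [hb i, Multiset.count_singleton, Multiset.count_singleton, if_neg (hq1 i), zero_add]
      split_ifs at h2 ⊢ with h h' h'
      · rfl
      · exact absurd h2.symm h'
      · exact absurd h'.symm (h3 h2).2
      · rfl
    · simp [hs i]
  · intro i a b s hQ
    have hab := hQ.1
    have hbs := hQ.2.1
    refine ⟨fun j => Nat.add_le_add_right (hab j) _,
      fun j => Nat.add_le_add (hbs j) (by split_ifs <;> simp), fun t h0 ha hb hs => ?_⟩
    beta_reduce at ha hb
    have hex : ∀ j, ∃ q ∈ t j, if j = i then ((3 : ℕ) : ℕ∞) ≤ q else q = 1 := by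
      intro j
      have h1 := hb j
      have h2 := ha j
      have h4 := hbs j
      split_ifs at h1 h2 ⊢ with h
      · exact Multiset.exists_three_le (h0 j) (by rw [h1, hs j]; omega)
      · exact ⟨1, Multiset.count_pos.1 (by omega), rfl⟩
    choose q hq hq2 using hex
    have hqi : ((3 : ℕ) : ℕ∞) ≤ q i := by simpa using hq2 i
    have hqj : ∀ j, j ≠ i → q j = 1 := fun j hj => by simpa [hj] using hq2 j
    refine step hQ h0 (realizable_linear (q := q) hx i (le_trans (by decide) hqi) hqj)
      (fun j => Multiset.singleton_le.2 (hq j)) (fun j => ?_) (fun j => ?_) fun j => by simp [hs j]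
    · rw [ha j, Multiset.count_singleton]
      by_cases hj : j = i
      · subst hj
        simp [(h3 hqi).1.symm]
      · simp [hj, hqj j hj]
    · rw [hb j, Multiset.count_singleton, Multiset.count_singleton]
      by_cases hj : j = i
      · subst hj
        simp [(h3 hqi).1.symm, (h3 hqi).2.symm]
      · simp [hj, hqj j hj, h12.symm]
  · intro i a b s hQ
    have hab := hQ.1
    have hbs := hQ.2.1
    refine ⟨fun j => Nat.add_le_add (hab j) (by split_ifs <;> simp),
      fun j => Nat.add_le_add_right (hbs j) _, fun t h0 ha hb hs => ?_⟩
    beta_reduce at ha hb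
    have hmem : ∀ j, (if j = i then 2 else 1) ∈ t j := by
      intro j
      have h1 := hb j
      have h2 := ha j
      have h4 := hab j
      split_ifs at h2 ⊢ with h
      · exact Multiset.count_pos.1 (by omega)
      · exact Multiset.count_pos.1 (by omega)
    refine step hQ h0 (realizable_linear (q := fun j => if j = i then 2 else 1) hx i (by simp)
      (fun j hj => if_neg hj)) (fun j => Multiset.singleton_le.2 (hmem j)) (fun j => ?_)
      (fun j => ?_) fun j => by simp [hs j]
    · rw [ha j, Multiset.count_singleton]
      by_cases hj : j = i
      · simp [hj, h12]
      · simp [hj]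
    · rw [hb j, Multiset.count_singleton, Multiset.count_singleton]
      by_cases hj : j = i
      · simp [hj, h12]
      · simp [hj, h12.symm]
  · intro a b s hQ
    refine ⟨fun j => Nat.add_le_add_right (hQ.1 j) _, fun j => Nat.add_le_add_right (hQ.2.1 j) _,
      fun t h0 ha hb hs => ?_⟩
    beta_reduce at ha hb
    refine step hQ h0 realizable_one (fun j => Multiset.singleton_le.2 (Multiset.count_pos.1
      (by rw [ha j]; exact Nat.succ_pos _))) (fun j => ?_) (fun j => ?_) fun j => by simp [hs j]
    · simp [ha j]
    · simp [hb j, h12.symm]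
  · intro i a b s hQ
    have hab := hQ.1
    have hbs := hQ.2.1
    refine ⟨fun j => Nat.add_le_add (hab j) (Nat.le_add_right _ _),
      fun j => Nat.add_le_add (hbs j) (by split_ifs <;> simp), fun t h0 ha hb hs => ?_⟩
    beta_reduce at ha hb
    have hex : ∀ j, ∃ q ∈ t j, if j = i then q = 2 else ((3 : ℕ) : ℕ∞) ≤ q := by
      intro j
      have h1 := hb j
      have h2 := ha j
      have h3 := hab j
      have h4 := hbs j
      split_ifs at h1 ⊢ with h
      · exact ⟨2, Multiset.count_pos.1 (by omega), rfl⟩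
      · exact Multiset.exists_three_le (h0 j) (by rw [h1, hs j]; omega)
    choose q hq hq2 using hex
    have hqi : q i = 2 := by simpa using hq2 i
    have hqj : ∀ j, j ≠ i → ((3 : ℕ) : ℕ∞) ≤ q j := fun j hj => by simpa [hj] using hq2 j
    have hq1 : ∀ j, 1 ≠ q j := by
      intro j
      by_cases hj : j = i
      · rw [hj, hqi]
        exact h12
      · exact (h3 (hqj j hj)).1.symm
    refine step hQ h0 (realizable_cubic_pair (q := q) hx i hqi hqj)
      (fun j => Multiset.singleton_add_singleton_le (hq1 j) (Multiset.count_pos.1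
        (by rw [ha j]; exact Nat.succ_pos _)) (hq j)) (fun j => ?_) (fun j => ?_)
      fun j => by simp [hs j]
    · rw [ha j, Multiset.count_add, Multiset.count_singleton, Multiset.count_singleton]
      simp [hq1 j]
    · rw [hb j, Multiset.count_add, Multiset.count_add]
      by_cases hj : j = i
      · subst hj
        simp [hqi, h12, h12.symm]
      · simp [hj, hq1 j, h12.symm, (h3 (hqj j hj)).2.symm]
  · intro i a b s hQ
    have hab := hQ.1
    have hbs := hQ.2.1
    refine ⟨fun j => Nat.add_le_add (hab j) (by split_ifs <;> simp),
      fun j => Nat.add_le_add (hbs j) (by split_ifs <;> simp), fun t h0 ha hb hs => ?_⟩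
    beta_reduce at ha hb
    have hex : ∀ j, ∃ q ∈ t j, if j = i then q = 2 else ((3 : ℕ) : ℕ∞) ≤ q := by
      intro j
      have h1 := hb j
      have h2 := ha j
      have h3 := hab j
      have h4 := hbs j
      split_ifs at h1 h2 ⊢ with h
      · exact ⟨2, Multiset.count_pos.1 (by omega), rfl⟩
      · exact Multiset.exists_three_le (h0 j) (by rw [h1, hs j]; omega)
    choose q hq hq2 using hex
    have hqi : q i = 2 := by simpa using hq2 i
    have hqj : ∀ j, j ≠ i → ((3 : ℕ) : ℕ∞) ≤ q j := fun j hj => by simpa [hj] using hq2 j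
    refine step hQ h0 (realizable_linear_pair (q := q) hx i hqi hqj) (fun j => ?_) (fun j => ?_)
      (fun j => ?_) fun j => by simp [hs j]
    · have h1 := hb j
      have h2 := ha j
      have h4 := hab j
      by_cases hj : j = i
      · subst hj
        rw [if_pos rfl, hqi]
        rw [if_pos rfl] at h1 h2
        exact Multiset.le_count_iff_replicate_le.1 (by omega : 2 ≤ (t j).count 2)
      · rw [if_neg hj]
        rw [if_neg hj] at h2
        exact Multiset.singleton_add_singleton_le (h3 (hqj j hj)).1.symm
          (Multiset.count_pos.1 (by omega)) (hq j)
    · rw [ha j, Multiset.count_add]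
      by_cases hj : j = i
      · subst hj
        simp [hqi, h12]
      · simp [hj, (h3 (hqj j hj)).1.symm]
    · rw [hb j, Multiset.count_add, Multiset.count_add]
      by_cases hj : j = i
      · subst hj
        simp [hqi, h12]
      · simp [hj, h12.symm, (h3 (hqj j hj)).1.symm,
          (h3 (hqj j hj)).2.symm]

end Sufficiency

/-! ### The classification for at most four points -/

theorem exists_isoParts (p : ℕ) [Fact p.Prime] (H : Type*) [AddCommGroup H] [Module ℤ_[p] H]
    [Module.Finite ℤ_[p] H] : ∃ t : Multiset ℕ∞, 0 ∉ t ∧ IsoParts p H t := by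
  obtain ⟨dInf, d, hd⟩ := exists_hasType p H
  obtain ⟨t, h0, ht, -⟩ := exists_isoParts_of_hasType hd
  exact ⟨t, h0, ht⟩

theorem memC_one (p : ℕ) [Fact p.Prime] (x : Fin 1 → ℤ_[p]) (hx : DistinctModP x)
    (H : Fin 1 → Type*) [∀ i, AddCommGroup (H i)] [∀ i, Module ℤ_[p] (H i)]
    [∀ i, Module.Finite ℤ_[p] (H i)] : MemC x H := by
  choose t h0 ht using fun i => exists_isoParts p (H i)
  exact memC_of_realizable (realizable_of_card_eq (by norm_num) hx (t 0).card t h0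
    fun i => by rw [Subsingleton.elim i 0]) ht

theorem memC_two_iff (p : ℕ) [Fact p.Prime] (x : Fin 2 → ℤ_[p]) (hx : DistinctModP x)
    (H : Fin 2 → Type*) [∀ i, AddCommGroup (H i)] [∀ i, Module ℤ_[p] (H i)]
    [∀ i, Module.Finite ℤ_[p] (H i)] : MemC x H ↔ pRank p (H 0) = pRank p (H 1) := by
  choose t h0 ht using fun i => exists_isoParts p (H i)
  rw [(ht 0).pRank_eq (h0 0), (ht 1).pRank_eq (h0 1)]
  refine ⟨fun h => h.card_eq ht h0 0 1, fun h => memC_of_realizable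
    (realizable_of_card_eq le_rfl hx (t 0).card t h0 fun i => ?_) ht⟩
  fin_cases i
  exacts [rfl, h.symm]

theorem memC_three_iff (p : ℕ) [Fact p.Prime] (x : Fin 3 → ℤ_[p]) (hx : DistinctModP x)
    (H : Fin 3 → Type*) [∀ i, AddCommGroup (H i)] [∀ i, Module ℤ_[p] (H i)]
    (dInf : Fin 3 → ℕ) (d : Fin 3 → ℕ+ →₀ ℕ) (hd : ∀ i, HasType p (H i) (dInf i) (d i)) :
    MemC x H ↔ (∀ i j, pRank p (H i) = pRank p (H j)) ∧ ∀ i, 2 * d i 1 ≤ ∑ k, d k 1 := by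
  choose t h0 ht hc using fun i => exists_isoParts_of_hasType (hd i)
  have h1 : ∀ i, d i 1 = (t i).count 1 := fun i => (hc i 1).symm
  have hr : ∀ i, pRank p (H i) = (t i).card := fun i => (ht i).pRank_eq (h0 i)
  simp only [h1, hr]
  constructor
  · refine fun h => ⟨fun i j => h.card_eq ht h0 i j, fun i => ?_⟩
    have h01 := MemC.triangle hx h ht h0 (i := 0) (j := 1) (k := 2) (by decide)
    have h10 := MemC.triangle hx h ht h0 (i := 1) (j := 0) (k := 2) (by decide)
    have h20 := MemC.triangle hx h ht h0 (i := 2) (j := 0) (k := 1) (by decide)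
    rw [Fin.sum_univ_three]
    fin_cases i <;> simp only [Fin.zero_eta, Fin.mk_one, Fin.reduceFinMk] <;> omega
  · rintro ⟨hs, h⟩
    exact memC_of_realizable (realizable_three hx t h0 (fun i => hs i 0) h) ht

theorem memC_four_iff (p : ℕ) [Fact p.Prime] (x : Fin 4 → ℤ_[p]) (hx : DistinctModP x)
    (H : Fin 4 → Type*) [∀ i, AddCommGroup (H i)] [∀ i, Module ℤ_[p] (H i)]
    (dInf : Fin 4 → ℕ) (d : Fin 4 → ℕ+ →₀ ℕ) (hd : ∀ i, HasType p (H i) (dInf i) (d i)) :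
    MemC x H ↔ (∀ i j, pRank p (H i) = pRank p (H j)) ∧ (∀ i, 3 * d i 1 ≤ ∑ k, d k 1) ∧
      ∀ i j, d i 1 + 2 * (d j 1 + d j 2) ≤ (∑ k, d k 1) + ∑ k, d k 2 := by
  choose t h0 ht hc using fun i => exists_isoParts_of_hasType (hd i)
  have h1 : ∀ i, d i 1 = (t i).count 1 := fun i => (hc i 1).symm
  have h2 : ∀ i, d i 2 = (t i).count 2 := fun i => (hc i 2).symm
  have hr : ∀ i, pRank p (H i) = (t i).card := fun i => (ht i).pRank_eq (h0 i)
  simp only [h1, h2, hr]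
  constructor
  · refine fun h => ⟨fun i j => h.card_eq ht h0 i j, MemC.four_points_one hx h ht h0,
      MemC.four_points_two hx h ht h0⟩
  · rintro ⟨hs, h3, h4⟩
    refine memC_of_realizable (realizable_four hx t h0 (fun i => hs i 0)
      ⟨fun i => Nat.le_add_right _ _, fun i => ?_, h3, fun i j => ?_⟩) ht
    · have h5 := Multiset.count_one_add_countP (h0 i)
      have h6 := Multiset.countP_le_eq_count_add (t i) 2
      rw [hs 0 i, ← h5, h6]
      exact Nat.add_le_add_left (Nat.le_add_right _ _) _
    · rw [Finset.sum_add_distrib]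
      exact h4 i j

theorem theorem1p8 (p : ℕ) [Fact p.Prime] :
    -- `m = 1`: every finitely generated module occurs
    (∀ x : Fin 1 → ℤ_[p], DistinctModP x →
      ∀ (H : Fin 1 → Type u) [∀ i, AddCommGroup (H i)] [∀ i, Module ℤ_[p] (H i)]
        [∀ i, Module.Finite ℤ_[p] (H i)],
        MemC x H) ∧
    -- `m = 2`
    (∀ x : Fin 2 → ℤ_[p], DistinctModP x →
      ∀ (H : Fin 2 → Type u) [∀ i, AddCommGroup (H i)] [∀ i, Module ℤ_[p] (H i)]
        [∀ i, Module.Finite ℤ_[p] (H i)],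
        MemC x H ↔ pRank p (H 0) = pRank p (H 1)) ∧
    -- `m = 3`
    (∀ x : Fin 3 → ℤ_[p], DistinctModP x →
      ∀ (H : Fin 3 → Type u) [∀ i, AddCommGroup (H i)] [∀ i, Module ℤ_[p] (H i)]
        [∀ i, Module.Finite ℤ_[p] (H i)]
        (dInf : Fin 3 → ℕ) (d : Fin 3 → ℕ+ →₀ ℕ), (∀ i, HasType p (H i) (dInf i) (d i)) →
        (MemC x H ↔
          (∀ i j, pRank p (H i) = pRank p (H j)) ∧
          ∀ i, 2 * d i 1 ≤ ∑ k, d k 1)) ∧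
    -- `m = 4`
    (∀ x : Fin 4 → ℤ_[p], DistinctModP x →
      ∀ (H : Fin 4 → Type u) [∀ i, AddCommGroup (H i)] [∀ i, Module ℤ_[p] (H i)]
        [∀ i, Module.Finite ℤ_[p] (H i)]
        (dInf : Fin 4 → ℕ) (d : Fin 4 → ℕ+ →₀ ℕ), (∀ i, HasType p (H i) (dInf i) (d i)) →
        (MemC x H ↔
          (∀ i j, pRank p (H i) = pRank p (H j)) ∧
          (∀ i, 3 * d i 1 ≤ ∑ k, d k 1) ∧
          ∀ i j, d i 1 + 2 * (d j 1 + d j 2) ≤ (∑ k, d k 1) + ∑ k, d k 2)) ∧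
    -- for `1 ≤ m ≤ 4` the set does not depend on the choice of `x_1, …, x_m`
    (∀ m : ℕ, 1 ≤ m → m ≤ 4 → ∀ x y : Fin m → ℤ_[p], DistinctModP x → DistinctModP y →
      ∀ (H : Fin m → Type u) [∀ i, AddCommGroup (H i)] [∀ i, Module ℤ_[p] (H i)]
        [∀ i, Module.Finite ℤ_[p] (H i)],
        MemC x H ↔ MemC y H) := by
  refine ⟨fun x hx H _ _ _ => memC_one p x hx H, fun x hx H _ _ _ => memC_two_iff p x hx H,
    fun x hx H _ _ _ dInf d hd => memC_three_iff p x hx H dInf d hd,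
    fun x hx H _ _ _ dInf d hd => memC_four_iff p x hx H dInf d hd, ?_⟩
  intro m hm1 hm4 x y hx hy H _ _ _
  choose dInf d hd using fun i => exists_hasType p (H i)
  interval_cases m
  · exact iff_of_true (memC_one p x hx H) (memC_one p y hy H)
  · exact (memC_two_iff p x hx H).trans (memC_two_iff p y hy H).symm
  · exact (memC_three_iff p x hx H dInf d hd).trans (memC_three_iff p y hy H dInf d hd).symm
  · exact (memC_four_iff p x hx H dInf d hd).trans (memC_four_iff p y hy H dInf d hd).symm
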